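/- Let $R$ be a Dedekind domain with field of fractions $k$ of characteristic $0$, such that $R/\mathfrak p$ is finite for every non-zero prime ideal $\mathfrak p$ of $R$. Let $A$ be a (finite-dimensional) central simple $k$-algebra and let $\Lambda \subset A$ be a maximal $R$-order, i.e. $\Lambda$ is an $R$-subalgebra which is finitely generated as an $R$-module and spans $A$ over $k$, and it is maximal with these properties. There is a unique $k$-linear map $\operatorname{trd}\colon A\to k$ (the reduced trace) such that $\operatorname{trd}(a)=\operatorname{tr}\varphi(1\otimes a)$ for every splitting field $\ell/k$, every splitting $\varphi\colon \ell\otimes_k A\cong M_n(\ell)$ and every $a\in A$; and there is a unique element $\operatorname{nrd}$ of the symmetric algebra $S_R(\Lambda^*)$, $\Lambda^*=\operatorname{Hom}_R(\Lambda,R)$ (the reduced norm), which on $\ell\otimes_R\Lambda=\ell\otimes_k A$ is given by $y\mapsto\det\varphi(y)$ for all such $\ell$ and $\varphi$. Moreover: 1. $\Lambda$ is smooth: the reduced trace maps $\Lambda$ into $R$, and $\operatorname{trd}\colon\Lambda\to R$ is surjective. 2. Consequently, the functor $\mathrm{SL}_\Lambda=\ker(\operatorname{nrd}\colon \mathrm{GL}_\Lambda\to\mathbb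 G_m)$, which sends a commutative $R$-algebra $C$ to the group $\{g\in(C\otimes_R\Lambda)^\times : \operatorname{nrd}(g)=1\}$, is a smooth affine group scheme over $R$: the reduced norm is a group homomorphism $(C\otimes_R\Lambda)^\times\to C^\times$ for every $C$, the functor is represented by the $R$-algebra $S_R(\Lambda^*)/(\operatorname{nrd}-1)$, this algebra is smooth over $R$, and for every commutative $R$-algebra $C$ and every nilpotent ideal $I\subseteq C$ the map $\mathrm{SL}_\Lambda(C)\to \mathrm{SL}_\Lambda(C/I)$ is surjective. -/

import Mathlib

open scoped TensorProduct

universe u v w x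

noncomputable section

/-- `Λ` is an `R`-order in the `k`-algebra `A`: an `R`-subalgebra which is finitely generated as an
`R`-module and spans `A` over `k`. A maximal order is `Maximal (IsOrderIn R k A) Λ`. -/
structure IsOrderIn (R : Type u) (k : Type v) (A : Type w) [CommRing R] [Field k] [Ring A]
    [Algebra k A] [Algebra R A] (Λ : Subalgebra R A) : Prop where
  fg : (Subalgebra.toSubmodule Λ).FG
  span_eq_top : Submodule.span k (Λ : Set A) = ⊤

/-- `t : A → k` is the reduced trace: for every splitting field `ℓ` of `A` and every splitting
`φ : ℓ ⊗ A ≃ Mₙ(ℓ)` it is the trace of the matrix `φ (1 ⊗ a)`. -/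
def IsReducedTrace (k : Type v) (A : Type w) [Field k] [Ring A] [Algebra k A]
    (t : A →ₗ[k] k) : Prop :=
  ∀ (ℓ : Type v) [Field ℓ] [Algebra k ℓ] (n : ℕ)
    (φ : ℓ ⊗[k] A ≃ₐ[ℓ] Matrix (Fin n) (Fin n) ℓ) (a : A),
    algebraMap k ℓ (t a) = Matrix.trace (φ (1 ⊗ₜ[k] a))

/-- The reduced trace `trd : A → k` of a central simple `k`-algebra `A`. -/
def reducedTrace (k : Type v) (A : Type w) [Field k] [Ring A] [Algebra k A] : A →ₗ[k] k :=
  Classical.epsilon (IsReducedTrace k A)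

/-- The order `Λ` is smooth: the reduced trace maps `Λ` into `R`, and onto `R`. -/
def IsSmoothOrder (R : Type u) (k : Type v) (A : Type w) [CommRing R] [Field k] [Algebra R k]
    [Ring A] [Algebra k A] [Algebra R A] (Λ : Subalgebra R A) : Prop :=
  reducedTrace k A '' (Λ : Set A) = Set.range (algebraMap R k)

/-- Evaluation of polynomial functions, that is, of elements of `S_R(M^*)`, at a point
`m ∈ C ⊗ M`. It sends a linear form `f` to `(id ⊗ f) m ∈ C ⊗ R = C`. -/
def evalAt {R : Type u} {M : Type w} [CommRing R] [AddCommGroup M] [Module R M]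
    {C : Type x} [CommRing C] [Algebra R C] (m : C ⊗[R] M) :
    SymmetricAlgebra R (Module.Dual R M) →ₐ[R] C :=
  SymmetricAlgebra.lift
    ((TensorProduct.rid R C).toLinearMap ∘ₗ LinearMap.applyₗ m ∘ₗ LinearMap.lTensorHom C)

/-- The homomorphism `ℓ ⊗_R Λ → ℓ ⊗_k A ≃ Mₙ(ℓ)`, `c ⊗ a ↦ φ (c ⊗ a)`. -/
def splittingHom {R : Type u} {k : Type v} {A : Type w} [CommRing R] [Field k] [Algebra R k]
    [Ring A] [Algebra k A] [Algebra R A] [IsScalarTower R k A] (Λ : Subalgebra R A)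
    {ℓ : Type v} [Field ℓ] [Algebra k ℓ] [Algebra R ℓ] [IsScalarTower R k ℓ] {n : ℕ}
    (φ : ℓ ⊗[k] A ≃ₐ[ℓ] Matrix (Fin n) (Fin n) ℓ) :
    ℓ ⊗[R] Λ →ₐ[ℓ] Matrix (Fin n) (Fin n) ℓ :=
  φ.toAlgHom.comp
    (Algebra.TensorProduct.lift (Algebra.TensorProduct.includeLeft : ℓ →ₐ[ℓ] ℓ ⊗[k] A)
      (((Algebra.TensorProduct.includeRight : A →ₐ[k] ℓ ⊗[k] A).restrictScalars R).comp Λ.val)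
      (fun c a => by
        simp [Commute, SemiconjBy, Algebra.TensorProduct.tmul_mul_tmul]))

/-- `ν ∈ S_R(Λ^*)` is the reduced norm on `Λ`: for every splitting field `ℓ` of `A` and every
splitting `φ : ℓ ⊗ A ≃ Mₙ(ℓ)` it is the determinant of the matrix `φ y`. (Over an infinite field `ℓ`
an identity between polynomial functions on `ℓ ⊗ Λ = ℓ ⊗ A` can be tested on `ℓ`-points.) -/
def IsReducedNorm (R : Type u) (k : Type v) (A : Type w) [CommRing R] [Field k] [Algebra R k]
    [Ring A] [Algebra k A] [Algebra R A] [IsScalarTower R k A] (Λ : Subalgebra R A)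
    (ν : SymmetricAlgebra R (Module.Dual R Λ)) : Prop :=
  ∀ (ℓ : Type v) [Field ℓ] [Algebra k ℓ] [Algebra R ℓ] [IsScalarTower R k ℓ] (n : ℕ)
    (φ : ℓ ⊗[k] A ≃ₐ[ℓ] Matrix (Fin n) (Fin n) ℓ) (y : ℓ ⊗[R] Λ),
    evalAt y ν = Matrix.det (splittingHom Λ φ y)

/-- The reduced norm `nrd ∈ S_R(Λ^*)` of the order `Λ`. -/
def reducedNorm (R : Type u) (k : Type v) (A : Type w) [CommRing R] [Field k] [Algebra R k]
    [Ring A] [Algebra k A] [Algebra R A] [IsScalarTower R k A] (Λ : Subalgebra R A) :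
    SymmetricAlgebra R (Module.Dual R Λ) :=
  Classical.epsilon (IsReducedNorm R k A Λ)

/-- The functor `SL_Λ` on commutative `R`-algebras: `SL_Λ(C)` is the set of units of `C ⊗ Λ` of
reduced norm one. -/
def SLPoints (R : Type u) (k : Type v) (A : Type w) [CommRing R] [Field k] [Algebra R k]
    [Ring A] [Algebra k A] [Algebra R A] [IsScalarTower R k A] (Λ : Subalgebra R A)
    (C : Type x) [CommRing C] [Algebra R C] : Set (C ⊗[R] Λ)ˣ :=
  {g | evalAt (g : C ⊗[R] Λ) (reducedNorm R k A Λ) = 1}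

/-- The map `GL_Λ(C) → GL_Λ(C')` induced by a homomorphism `C → C'`. -/
def GLMap {R : Type u} {A : Type w} [CommRing R] [Ring A] [Algebra R A] (Λ : Subalgebra R A)
    {C C' : Type x} [CommRing C] [Algebra R C] [CommRing C'] [Algebra R C'] (f : C →ₐ[R] C') :
    (C ⊗[R] Λ)ˣ →* (C' ⊗[R] Λ)ˣ :=
  Units.map (Algebra.TensorProduct.map f (AlgHom.id R Λ) : C ⊗[R] Λ →* C' ⊗[R] Λ)

/-- The coordinate ring `S_R(Λ^*) / (nrd - 1)`. -/
abbrev SLCoord (R : Type u) (k : Type v) (A : Type w) [CommRing R] [Field k] [Algebra R k]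
    [Ring A] [Algebra k A] [Algebra R A] [IsScalarTower R k A] (Λ : Subalgebra R A) :
    Type (max u w) :=
  SymmetricAlgebra R (Module.Dual R Λ) ⧸
    Ideal.span {reducedNorm R k A Λ - 1}

/-- `SL_Λ` is a smooth affine group scheme over `R`. -/
structure IsSmoothGroupSchemeSL (R : Type u) (k : Type v) (A : Type w) [CommRing R] [Field k]
    [Algebra R k] [Ring A] [Algebra k A] [Algebra R A] [IsScalarTower R k A]
    (Λ : Subalgebra R A) : Prop where
  /-- The reduced norm is a homomorphism `GL_Λ → 𝔾ₘ`, and `SL_Λ` is its kernel; in particular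
  `SL_Λ` is a functor to groups. -/
  eq_ker : ∀ (C : Type x) [CommRing C] [Algebra R C], ∃ N : (C ⊗[R] Λ)ˣ →* Cˣ,
    (∀ g : (C ⊗[R] Λ)ˣ, (N g : C) = evalAt (g : C ⊗[R] Λ) (reducedNorm R k A Λ)) ∧
    (N.ker : Set (C ⊗[R] Λ)ˣ) = SLPoints R k A Λ C
  /-- The functor `SL_Λ` is represented by its coordinate ring: evaluation identifies `SL_Λ(C)` with
  the set of `R`-algebra homomorphisms from the coordinate ring to `C`. -/
  representable : ∀ (C : Type x) [CommRing C] [Algebra R C],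
    (∀ g ∈ SLPoints R k A Λ C, ∃! p : SLCoord R k A Λ →ₐ[R] C,
      p.comp (Ideal.Quotient.mkₐ R _) = evalAt (g : C ⊗[R] Λ)) ∧
    (∀ p : SLCoord R k A Λ →ₐ[R] C, ∃! g : (C ⊗[R] Λ)ˣ, g ∈ SLPoints R k A Λ C ∧
      p.comp (Ideal.Quotient.mkₐ R _) = evalAt (g : C ⊗[R] Λ))
  /-- The coordinate ring is a smooth `R`-algebra (formally smooth and of finite presentation). -/
  smooth : Algebra.Smooth R (SLCoord R k A Λ)
  /-- Points lift along nilpotent ideals. -/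
  lift : ∀ (C : Type x) [CommRing C] [Algebra R C] (I : Ideal C), IsNilpotent I →
    ∀ g' ∈ SLPoints R k A Λ (C ⧸ I), ∃ g ∈ SLPoints R k A Λ C,
      GLMap Λ (Ideal.Quotient.mkₐ R I) g = g'

end

open scoped TensorProduct Matrix

/-! Three arguments carry the theorem.

Norm. In a splitting, the determinant of the generic element of `Λ` is a polynomial whose `n`-th
power is the determinant of right multiplication, a polynomial over `R` (`genericDet_pow`). Its
coefficients are therefore integral over `R`. They are Galois invariant, since an `n`-th root taking
the value `1` at the identity is unique. As `R` is integrally closed, the polynomial descends to `R`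
(`exists_isNormPoly`). The reduced trace is `1/n` times the trace of right multiplication.

Smoothness of `SL`. Since `nrd (1 + t a) = 1 + t trd a` when `t ^ 2 = 0`, an element `a` of `Λ` with
`trd a = 1` corrects any lift of a norm-one point along a square-zero ideal
(`exists_evalAt_eq_one_of_sq_zero`). Points of unit norm are units, so the symmetric algebra modulo
`nrd - 1` represents `SL`.

Surjectivity of the trace. The trace takes values in `R` because it is a coefficient of the norm. It
suffices to find, at each non-zero prime, an element whose trace is a local unit. Let `O` be the
localization, with prime element `π` and residue field of `q` elements, and let `L` be the localized
order. A count of indices, which uses maximality through right idealizers, gives `x` in `L` with `π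
∈ L x` and `S = L / L x` simple (`exists_isSimpleModule_quotient_span_singleton`). As `x` is not a
unit, `π` divides `nrd x`, so `π ^ n` divides the determinant of right multiplication by `x`, and
`S` has at least `q ^ n` elements. By the density theorem and Wedderburn's theorem, some `a` in `L`
acts on `S` as multiplication by a normal basis generator `θ` of the field with `|S|` elements. The
reduced characteristic polynomial of `a` has degree `n` and kills `θ` modulo `π`. Comparing degrees,
`|S| = q ^ n` and this polynomial reduces to the minimal polynomial of `θ`, whose trace coefficient
is non-zero. -/

/-! ### Splitting of central simple algebras. -/

theorem isSimpleRing_tensorProduct_field (k : Type*) (A : Type*) (ℓ : Type*) [Field k] [Ring A]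
    [Algebra k A] [Algebra.IsCentral k A] [IsSimpleRing A] [Field ℓ] [Algebra k ℓ] :
    IsSimpleRing (ℓ ⊗[k] A) := by
  classical
  let b := Module.Basis.ofVectorSpace k ℓ
  let c := TensorProduct.equivFinsuppOfBasisLeft (N := A) b
  have hcl : ∀ (a : A) (y : ℓ ⊗[k] A) i, c ((1 ⊗ₜ a) * y) i = a * c y i := by
    intro a y i
    induction y with
    | zero => simp
    | tmul l d => simp [c, TensorProduct.equivFinsuppOfBasisLeft_apply_tmul]
    | add y z hy hz => simp only [mul_add, map_add, Finsupp.add_apply, hy, hz]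
  have hcr : ∀ (a : A) (y : ℓ ⊗[k] A) i, c (y * (1 ⊗ₜ a)) i = c y i * a := by
    intro a y i
    induction y with
    | zero => simp
    | tmul l d => simp [c, TensorProduct.equivFinsuppOfBasisLeft_apply_tmul]
    | add y z hy hz => simp only [add_mul, map_add, Finsupp.add_apply, hy, hz]
  have hnt : Nontrivial (ℓ ⊗[k] A) := inferInstance
  refine isSimpleRing_iff_isTwoSided_imp.2 ⟨hnt, fun I hI => ?_⟩
  rw [or_iff_not_imp_left]
  intro hbot
  obtain ⟨x₀, hx₀I, hx₀⟩ := Submodule.exists_mem_ne_zero_of_ne_bot hbot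
  -- An element of `I` whose support in the basis `b` has minimal size is shown to lead to a pure
  -- tensor `l ⊗ 1`, which is a unit.
  have hex : ∃ m : ℕ, ∃ x ∈ I, x ≠ 0 ∧ (c x).support.card = m := ⟨_, x₀, hx₀I, hx₀, rfl⟩
  obtain ⟨x, hxI, hx, hxm⟩ := Nat.find_spec hex
  have hmin : ∀ y ∈ I, (c y).support ⊂ (c x).support → y = 0 := by
    intro y hy hlt
    by_contra h0
    exact Nat.find_min hex (hxm ▸ Finset.card_lt_card hlt) ⟨y, hy, h0, rfl⟩
  obtain ⟨i, hi⟩ : (c x).support.Nonempty := by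
    rw [Finsupp.support_nonempty_iff]
    simpa using hx
  -- By simplicity of `A` this ideal contains `1`, so the minimal element can be normalised to have
  -- coefficient `1` at `i`.
  let J : TwoSidedIdeal A := TwoSidedIdeal.mk'
    {a | ∃ y ∈ I, (c y).support ⊆ (c x).support ∧ c y i = a}
    ⟨0, I.zero_mem, by simp, by simp⟩
    (by
      rintro _ _ ⟨y, hy, hs, rfl⟩ ⟨z, hz, ht, rfl⟩
      exact ⟨y + z, I.add_mem hy hz, by
        rw [map_add]; exact Finsupp.support_add.trans (Finset.union_subset hs ht), by simp⟩)
    (by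
      rintro _ ⟨y, hy, hs, rfl⟩
      exact ⟨-y, I.neg_mem hy, by simpa using hs, by simp⟩)
    (by
      rintro a _ ⟨y, hy, hs, rfl⟩
      refine ⟨(1 ⊗ₜ a) * y, I.mul_mem_left _ hy, fun j hj => hs ?_, hcl a y i⟩
      rw [Finsupp.mem_support_iff, hcl] at hj
      exact Finsupp.mem_support_iff.2 (right_ne_zero_of_mul hj))
    (by
      rintro _ a ⟨y, hy, hs, rfl⟩
      refine ⟨y * (1 ⊗ₜ a), I.mul_mem_right _ hy, fun j hj => hs ?_, hcr a y i⟩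
      rw [Finsupp.mem_support_iff, hcr] at hj
      exact Finsupp.mem_support_iff.2 (left_ne_zero_of_mul hj))
  have h1 : (1 : A) ∈ J := IsSimpleRing.one_mem_of_ne_zero_mem J (Finsupp.mem_support_iff.1 hi)
    ((TwoSidedIdeal.mem_mk' ..).2 ⟨x, hxI, subset_rfl, rfl⟩)
  obtain ⟨y, hyI, hys, hyi⟩ := (TwoSidedIdeal.mem_mk' ..).1 h1
  -- The commutator has coefficient `a - a = 0` at `i`, so it vanishes by minimality; hence all
  -- coefficients of `y` are central.
  have hcomm : ∀ a : A, (1 ⊗ₜ a) * y - y * (1 ⊗ₜ a) = 0 := by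
    intro a
    refine hmin _ (I.sub_mem (I.mul_mem_left _ hyI) (I.mul_mem_right _ hyI)) ?_
    rw [Finset.ssubset_iff_of_subset]
    · exact ⟨i, hi, by simp [hcl, hcr, hyi]⟩
    · intro j hj
      refine hys (Finsupp.mem_support_iff.2 fun h0 => Finsupp.mem_support_iff.1 hj ?_)
      simp [hcl, hcr, h0]
  have hcen : ∀ j, ∃ r : k, c y j = algebraMap k A r := by
    intro j
    refine (Algebra.IsCentral.mem_center_iff k).1 (Subalgebra.mem_center_iff.2 fun a => ?_)
    have := congrArg (fun z => c z j) (hcomm a)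
    simpa [hcl, hcr, sub_eq_zero] using this
  choose r hr using hcen
  have hy : y = (∑ j ∈ (c y).support, r j • b j) ⊗ₜ 1 := by
    have h2 : y = (c y).sum fun j a => b j ⊗ₜ a := by
      rw [← TensorProduct.equivFinsuppOfBasisLeft_symm_apply]
      exact (c.symm_apply_apply y).symm
    rw [TensorProduct.sum_tmul]
    conv_lhs => rw [h2]
    refine Finset.sum_congr rfl fun j _ => ?_
    simp only []
    rw [hr, Algebra.algebraMap_eq_smul_one, TensorProduct.tmul_smul, TensorProduct.smul_tmul']
  set l := ∑ j ∈ (c y).support, r j • b j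
  have hl : l ≠ 0 := by
    rintro h0
    rw [h0, TensorProduct.zero_tmul] at hy
    rw [hy] at hyi
    simp at hyi
  rw [Ideal.eq_top_iff_one]
  have := I.mul_mem_left (l⁻¹ ⊗ₜ 1) hyI
  rwa [hy, Algebra.TensorProduct.tmul_mul_tmul, inv_mul_cancel₀ hl, one_mul,
    ← Algebra.TensorProduct.one_def] at this

/-- A central simple algebra splits over the algebraic closure of its centre. -/
theorem exists_splitting_algebraicClosure (k : Type*) (A : Type*) [Field k] [Ring A]
    [Algebra k A] [FiniteDimensional k A] [Algebra.IsCentral k A] [IsSimpleRing A] :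
    ∃ n : ℕ, n ≠ 0 ∧ Nonempty (AlgebraicClosure k ⊗[k] A ≃ₐ[AlgebraicClosure k]
      Matrix (Fin n) (Fin n) (AlgebraicClosure k)) := by
  have := isSimpleRing_tensorProduct_field k A (AlgebraicClosure k)
  obtain ⟨n, hn, h⟩ := IsSimpleRing.exists_algEquiv_matrix_of_isAlgClosed (AlgebraicClosure k)
    (AlgebraicClosure k ⊗[k] A)
  exact ⟨n, hn.ne, h⟩

theorem finrank_eq_sq_of_splitting {k A ℓ : Type*} [Field k] [Ring A] [Algebra k A]
    [Field ℓ] [Algebra k ℓ] {n : ℕ} (φ : ℓ ⊗[k] A ≃ₐ[ℓ] Matrix (Fin n) (Fin n) ℓ) :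
    Module.finrank k A = n ^ 2 := by
  rw [← Module.finrank_baseChange (R := ℓ), φ.toLinearEquiv.finrank_eq, Module.finrank_matrix]
  simp [sq]

/-! ### Determinant and trace of right multiplication on matrices. -/

theorem Matrix.toMatrix_mulRight {n ℓ : Type*} [Fintype n] [DecidableEq n] [CommRing ℓ]
    (Y : Matrix n n ℓ) :
    LinearMap.toMatrix (Matrix.stdBasis ℓ n n) (Matrix.stdBasis ℓ n n) (LinearMap.mulRight ℓ Y) =
      Matrix.kronecker 1 Y.transpose := by
  ext ⟨i, j⟩ ⟨i', j'⟩
  rw [LinearMap.toMatrix_apply, Matrix.stdBasis_eq_single]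
  have : ∀ Z : Matrix n n ℓ, (Matrix.stdBasis ℓ n n).repr Z (i, j) = Z i j := by
    intro Z
    simp [Matrix.stdBasis]
  rw [this]
  rw [LinearMap.mulRight_apply, Matrix.mul_apply]
  by_cases h : i = i' <;> simp [Matrix.single_apply, h, eq_comm]

theorem Matrix.det_mulRight {n ℓ : Type*} [Fintype n] [DecidableEq n] [CommRing ℓ]
    (Y : Matrix n n ℓ) : LinearMap.det (LinearMap.mulRight ℓ Y) = Y.det ^ Fintype.card n := by
  rw [← LinearMap.det_toMatrix (Matrix.stdBasis ℓ n n), Matrix.toMatrix_mulRight, Matrix.kronecker,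
    Matrix.det_kronecker]
  simp

theorem Matrix.trace_mulRight {n ℓ : Type*} [Fintype n] [DecidableEq n] [CommRing ℓ]
    (Y : Matrix n n ℓ) :
    LinearMap.trace ℓ _ (LinearMap.mulRight ℓ Y) = Fintype.card n * Y.trace := by
  rw [LinearMap.trace_eq_matrix_trace ℓ (Matrix.stdBasis ℓ n n), Matrix.toMatrix_mulRight,
    Matrix.kronecker, Matrix.trace_kronecker]
  simp

/-- A Weinstein–Aronszajn computation: the right multiplication by `Y`, transported to `ℓ ^ N` along
a retraction `ℓ ^ N → Mₙ(ℓ)` and extended by the identity, has determinant `det Y ^ n`. -/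
theorem Matrix.det_one_sub_add_mulRight {n N : ℕ} {ℓ : Type*} [CommRing ℓ]
    (E : Fin N → Matrix (Fin n) (Fin n) ℓ) (Φ : Fin N → Matrix (Fin n) (Fin n) ℓ →ₗ[ℓ] ℓ)
    (h : ∀ Z, ∑ j, Φ j Z • E j = Z) (Y : Matrix (Fin n) (Fin n) ℓ) :
    Matrix.det (Matrix.of fun i j : Fin N =>
      (if i = j then 1 else 0) - Φ i (E j) + Φ i (E j * Y)) = Y.det ^ n := by
  let s := Matrix.stdBasis ℓ (Fin n) (Fin n)
  let t := Pi.basisFun ℓ (Fin N)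
  let I : Matrix (Fin n) (Fin n) ℓ →ₗ[ℓ] (Fin N → ℓ) := LinearMap.pi Φ
  let P : (Fin N → ℓ) →ₗ[ℓ] Matrix (Fin n) (Fin n) ℓ := Fintype.linearCombination ℓ E
  have hPI : P ∘ₗ I = LinearMap.id := by
    ext1 Z
    simpa [P, I, Fintype.linearCombination_apply] using h Z
  have h1 : (Matrix.of fun i j : Fin N => (if i = j then 1 else 0) - Φ i (E j) + Φ i (E j * Y)) =
      1 + LinearMap.toMatrix s t (I ∘ₗ (LinearMap.mulRight ℓ Y - LinearMap.id)) *
        LinearMap.toMatrix t s P := by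
    rw [← LinearMap.toMatrix_comp]
    ext i j
    simp only [Matrix.of_apply, Matrix.add_apply, Matrix.one_apply, LinearMap.toMatrix_apply, t]
    simp [P, I, Fintype.linearCombination_apply_single]
    ring
  rw [h1, Matrix.det_one_add_mul_comm, ← LinearMap.toMatrix_comp, ← LinearMap.comp_assoc, hPI,
    LinearMap.id_comp, map_sub, LinearMap.toMatrix_id, add_sub_cancel, LinearMap.det_toMatrix,
    Matrix.det_mulRight, Fintype.card_fin]

/-! ### Polynomial functions on a finitely generated projective module. -/

/-- A finite dual basis of a (finitely generated projective) module. -/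
structure FiniteDualBasis (R : Type*) (M : Type*) [CommRing R] [AddCommGroup M] [Module R M]
    (N : ℕ) where
  /-- The generators. -/
  e : Fin N → M
  /-- The coordinate functionals. -/
  f : Fin N → Module.Dual R M
  sum_smul : ∀ m, ∑ j, f j m • e j = m

theorem exists_finiteDualBasis (R M : Type*) [CommRing R] [AddCommGroup M] [Module R M]
    [Module.Finite R M] [Module.Projective R M] : ∃ N, Nonempty (FiniteDualBasis R M N) := by
  obtain ⟨N, p, i, -, -, h⟩ := Module.Finite.exists_comp_eq_id_of_projective R M
  refine ⟨N, ⟨⟨fun j => p (Pi.single j 1), fun j => LinearMap.proj j ∘ₗ i, fun m => ?_⟩⟩⟩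
  conv_rhs => rw [← LinearMap.id_apply (R := R) m, ← h, LinearMap.comp_apply,
    LinearMap.pi_apply_eq_sum_univ p]
  refine Finset.sum_congr rfl fun j _ => ?_
  congr 2
  ext l
  simp [Pi.single_apply, eq_comm]

theorem SymmetricAlgebra.algHom_ext_apply {R M B : Type*} [CommRing R] [AddCommGroup M]
    [Module R M] [CommRing B] [Algebra R B] {F G : SymmetricAlgebra R M →ₐ[R] B}
    (h : ∀ m, F (SymmetricAlgebra.ι R M m) = G (SymmetricAlgebra.ι R M m)) : F = G :=
  SymmetricAlgebra.algHom_ext (LinearMap.ext h)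

section evalAt

variable {R M C C' : Type*} [CommRing R] [AddCommGroup M] [Module R M] [CommRing C] [Algebra R C]
  [CommRing C'] [Algebra R C']

theorem evalAt_ι (m : C ⊗[R] M) (g : Module.Dual R M) :
    evalAt m (SymmetricAlgebra.ι R _ g) = TensorProduct.rid R C (LinearMap.lTensor C g m) := by
  simp [evalAt]

theorem evalAt_tmul_ι (c : C) (m : M) (g : Module.Dual R M) :
    evalAt (c ⊗ₜ[R] m) (SymmetricAlgebra.ι R _ g) = g m • c := by
  simp [evalAt_ι]

theorem evalAt_add_ι (m m' : C ⊗[R] M) (g : Module.Dual R M) :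
    evalAt (m + m') (SymmetricAlgebra.ι R _ g) =
      evalAt m (SymmetricAlgebra.ι R _ g) + evalAt m' (SymmetricAlgebra.ι R _ g) := by
  simp [evalAt_ι]

theorem evalAt_rTensor (h : C →ₐ[R] C') (m : C ⊗[R] M) (s : SymmetricAlgebra R (Module.Dual R M)) :
    evalAt (LinearMap.rTensor M h.toLinearMap m) s = h (evalAt m s) := by
  rw [← AlgHom.comp_apply]
  congr 1
  refine SymmetricAlgebra.algHom_ext_apply fun g => ?_
  rw [AlgHom.comp_apply]
  induction m with
  | zero => simp [evalAt_ι]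
  | tmul c m => simp [evalAt_tmul_ι]
  | add m m' h1 h2 => rw [map_add, evalAt_add_ι, h1, h2, evalAt_add_ι, map_add]

namespace FiniteDualBasis

variable {N : ℕ} (D : FiniteDualBasis R M N)

/-- The coordinates of a point of `C ⊗ M`. -/
noncomputable def coord (m : C ⊗[R] M) (j : Fin N) : C := evalAt m (SymmetricAlgebra.ι R _ (D.f j))

/-- The point of `C ⊗ M` with given coordinates (the latter are not unique). -/
noncomputable def point (v : Fin N → C) : C ⊗[R] M := ∑ j, v j ⊗ₜ D.e j

/-- A polynomial function on `M` as a polynomial in the coordinates. -/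
noncomputable def toPoly : SymmetricAlgebra R (Module.Dual R M) →ₐ[R] MvPolynomial (Fin N) R :=
  SymmetricAlgebra.lift (∑ j, (Module.Dual.eval R M (D.e j)).smulRight (MvPolynomial.X j))

/-- The polynomial function on `M` defined by a polynomial in the coordinates. -/
noncomputable def ofPoly : MvPolynomial (Fin N) R →ₐ[R] SymmetricAlgebra R (Module.Dual R M) :=
  MvPolynomial.aeval fun j => SymmetricAlgebra.ι R _ (D.f j)

theorem toPoly_ι (g : Module.Dual R M) :
    D.toPoly (SymmetricAlgebra.ι R _ g) = ∑ j, g (D.e j) • MvPolynomial.X j := by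
  simp [toPoly]

theorem coord_tmul (c : C) (m : M) (j : Fin N) : D.coord (c ⊗ₜ m) j = D.f j m • c :=
  evalAt_tmul_ι _ _ _

theorem coord_add (m m' : C ⊗[R] M) : D.coord (m + m') = D.coord m + D.coord m' :=
  funext fun _ => evalAt_add_ι _ _ _

theorem point_add (v v' : Fin N → C) : D.point (v + v') = D.point v + D.point v' := by
  simp [point, TensorProduct.add_tmul, Finset.sum_add_distrib]

theorem point_coord (m : C ⊗[R] M) : D.point (D.coord m) = m := by
  induction m with
  | zero => simp [point, coord, evalAt_ι]
  | tmul c m =>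
    simp only [point, coord_tmul, TensorProduct.smul_tmul, ← TensorProduct.tmul_sum, D.sum_smul]
  | add m m' h h' => rw [coord_add, point_add, h, h']

theorem sum_apply_smul_f (g : Module.Dual R M) : ∑ j, g (D.e j) • D.f j = g := by
  ext m
  conv_rhs => rw [← D.sum_smul m]
  simp [mul_comm]

/-- Exhibits the symmetric algebra as a retract of a polynomial ring; computations with polynomial
functions are carried out there. -/
theorem ofPoly_toPoly (s : SymmetricAlgebra R (Module.Dual R M)) : D.ofPoly (D.toPoly s) = s := by
  have : D.ofPoly.comp D.toPoly = AlgHom.id R _ := by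
    refine SymmetricAlgebra.algHom_ext_apply fun g => ?_
    conv_rhs => rw [← D.sum_apply_smul_f g]
    simp [toPoly_ι, ofPoly]
  exact DFunLike.congr_fun this s

theorem ofPoly_surjective : Function.Surjective D.ofPoly := fun s => ⟨_, D.ofPoly_toPoly s⟩

theorem evalAt_ofPoly (m : C ⊗[R] M) (F : MvPolynomial (Fin N) R) :
    evalAt m (D.ofPoly F) = MvPolynomial.aeval (D.coord m) F := by
  rw [← AlgHom.comp_apply]
  congr 1
  ext j
  simp [ofPoly, coord]

theorem evalAt_point (v : Fin N → C) (s : SymmetricAlgebra R (Module.Dual R M)) :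
    evalAt (D.point v) s = MvPolynomial.aeval v (D.toPoly s) := by
  rw [← AlgHom.comp_apply]
  congr 1
  refine SymmetricAlgebra.algHom_ext_apply fun g => ?_
  rw [AlgHom.comp_apply, toPoly_ι, evalAt_ι, point]
  simp

end FiniteDualBasis

theorem evalAt_injective [Module.Finite R M] [Module.Projective R M] {m m' : C ⊗[R] M}
    (h : evalAt m = evalAt m') : m = m' := by
  obtain ⟨N, ⟨D⟩⟩ := exists_finiteDualBasis R M
  rw [← D.point_coord m, ← D.point_coord m']
  unfold FiniteDualBasis.coord
  rw [h]

/-- With `evalAt_injective`: the symmetric algebra of the dual represents the functor `C ↦ C ⊗ M`.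
-/
theorem evalAt_surjective [Module.Finite R M] [Module.Projective R M]
    (p : SymmetricAlgebra R (Module.Dual R M) →ₐ[R] C) : ∃ m : C ⊗[R] M, evalAt m = p := by
  obtain ⟨N, ⟨D⟩⟩ := exists_finiteDualBasis R M
  refine ⟨D.point fun j => p (SymmetricAlgebra.ι R _ (D.f j)), ?_⟩
  refine SymmetricAlgebra.algHom_ext_apply fun g => ?_
  rw [D.evalAt_point, D.toPoly_ι]
  conv_rhs => rw [← D.sum_apply_smul_f g]
  simp

/-- Two polynomial functions on `M` which agree over an infinite domain are equal. -/
theorem eq_of_evalAt_eq {ℓ : Type*} [CommRing ℓ] [IsDomain ℓ] [Infinite ℓ] [Algebra R ℓ]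
    [FaithfulSMul R ℓ] [Module.Finite R M] [Module.Projective R M]
    {s s' : SymmetricAlgebra R (Module.Dual R M)}
    (h : ∀ y : ℓ ⊗[R] M, evalAt y s = evalAt y s') : s = s' := by
  obtain ⟨N, ⟨D⟩⟩ := exists_finiteDualBasis R M
  rw [← D.ofPoly_toPoly s, ← D.ofPoly_toPoly s']
  congr 1
  refine MvPolynomial.map_injective _ (FaithfulSMul.algebraMap_injective R ℓ)
    (MvPolynomial.funext fun v => ?_)
  simpa [D.evalAt_point, MvPolynomial.eval_map, MvPolynomial.aeval_def] using h (D.point v)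

end evalAt

/-! ### Coordinates on an order and their extension to a splitting. -/

section order

variable {R : Type u} {k : Type v} {A : Type w} [CommRing R] [IsDomain R] [Field k] [Algebra R k]
  [IsFractionRing R k] [Ring A] [Algebra k A] [Algebra R A] [IsScalarTower R k A]
  {Λ : Subalgebra R A}

theorem exists_smul_mem_of_span_eq_top (hΛ : Submodule.span k (Λ : Set A) = ⊤) (a : A) :
    ∃ r : R, r ≠ 0 ∧ r • a ∈ Λ := by
  have ha : a ∈ Submodule.span k (Λ : Set A) := hΛ ▸ Submodule.mem_top
  induction ha using Submodule.span_induction with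
  | mem x h => exact ⟨1, one_ne_zero, by simpa using h⟩
  | zero => exact ⟨1, one_ne_zero, by simp⟩
  | add x y _ _ hx hy =>
    obtain ⟨r, hr, hx⟩ := hx
    obtain ⟨s, hs, hy⟩ := hy
    refine ⟨r * s, mul_ne_zero hr hs, ?_⟩
    rw [smul_add]
    refine Λ.add_mem ?_ ?_
    · rw [mul_comm, mul_smul]; exact Λ.smul_mem hx s
    · rw [mul_smul]; exact Λ.smul_mem hy r
  | smul c x _ hx =>
    obtain ⟨r, hr, hx⟩ := hx
    obtain ⟨p, q, hq, rfl⟩ := IsFractionRing.div_surjective (A := R) c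
    have hq0 : algebraMap R k q ≠ 0 := by
      simpa using nonZeroDivisors.ne_zero hq
    refine ⟨r * q, mul_ne_zero hr (nonZeroDivisors.ne_zero hq), ?_⟩
    have : (r * q) • (algebraMap R k p / algebraMap R k q) • x = p • r • x := by
      rw [← algebraMap_smul k (r * q), ← algebraMap_smul k p, ← algebraMap_smul k r,
        smul_smul, smul_smul, map_mul]
      congr 1
      field_simp
    rw [this]
    exact Λ.smul_mem hx p

/-- Makes `A` the base change of `Λ` to `k`, so that functionals on `Λ` extend to `A`. -/
theorem isLocalizedModule_val (hΛ : Submodule.span k (Λ : Set A) = ⊤) :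
    IsLocalizedModule (nonZeroDivisors R) Λ.val.toLinearMap where
  map_units r := by
    have hr : algebraMap R k r ≠ 0 := by simp
    rw [Module.End.isUnit_iff]
    constructor
    · intro a b h
      simp only [Module.algebraMap_end_apply] at h
      rw [← algebraMap_smul k, ← algebraMap_smul k (r : R) b] at h
      exact smul_right_injective _ hr h
    · intro a
      refine ⟨(algebraMap R k r)⁻¹ • a, ?_⟩
      simp only [Module.algebraMap_end_apply]
      rw [← algebraMap_smul k, smul_inv_smul₀ hr]
  surj a := by
    obtain ⟨r, hr, h⟩ := exists_smul_mem_of_span_eq_top hΛ a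
    exact ⟨(⟨r • a, h⟩, ⟨r, mem_nonZeroDivisors_of_ne_zero hr⟩), rfl⟩
  exists_of_eq h := ⟨1, by simpa using Subtype.ext h⟩

/-- The coordinates of an order, extended to a splitting. -/
theorem FiniteDualBasis.exists_extension (hΛ : Submodule.span k (Λ : Set A) = ⊤) {N : ℕ}
    (D : FiniteDualBasis R Λ N) {ℓ : Type*} [Field ℓ] [Algebra k ℓ] [Algebra R ℓ]
    [IsScalarTower R k ℓ] {B : Type*} [Ring B] [Algebra ℓ B] (φ : ℓ ⊗[k] A ≃ₐ[ℓ] B) :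
    ∃ Φ : Fin N → B →ₗ[ℓ] ℓ, (∀ Z, ∑ j, Φ j Z • φ (1 ⊗ₜ (D.e j : A)) = Z) ∧
      ∀ i (a : Λ), Φ i (φ (1 ⊗ₜ (a : A))) = algebraMap R ℓ (D.f i a) := by
  have := isLocalizedModule_val hΛ
  have hb : IsBaseChange k Λ.val.toLinearMap := IsLocalizedModule.isBaseChange (nonZeroDivisors R) k
      _
  let f : Fin N → A →ₗ[k] k := fun j => hb.lift (Algebra.linearMap R k ∘ₗ D.f j)
  have hf : ∀ j (a : Λ), f j a = algebraMap R k (D.f j a) := fun j a => hb.lift_eq _ a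
  have hsum : ∀ a, ∑ j, f j a • (D.e j : A) = a := by
    intro a
    have h1 : ∑ j, (f j).smulRight (D.e j : A) = LinearMap.id := by
      refine hb.algHom_ext _ _ fun a => ?_
      have := congrArg (Subtype.val : Λ → A) (D.sum_smul a)
      simpa [hf, algebraMap_smul] using this
    simpa using DFunLike.congr_fun h1 a
  let g : Fin N → ℓ ⊗[k] A →ₗ[ℓ] ℓ := fun j =>
    (TensorProduct.AlgebraTensorModule.rid k ℓ ℓ).toLinearMap ∘ₗ (f j).baseChange ℓ
  have hg : ∀ j l a, g j (l ⊗ₜ a) = f j a • l := by intro j l a; simp [g]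
  refine ⟨fun j => g j ∘ₗ φ.symm.toLinearMap, fun Z => ?_, fun i a => ?_⟩
  · obtain ⟨y, rfl⟩ := φ.surjective Z
    simp only [LinearMap.comp_apply, AlgEquiv.toLinearMap_apply, AlgEquiv.symm_apply_apply]
    simp only [← map_smul, ← map_sum]
    congr 1
    induction y with
    | zero => simp
    | tmul l a =>
      simp only [hg]
      conv_rhs => rw [← hsum a, TensorProduct.tmul_sum]
      refine Finset.sum_congr rfl fun j _ => ?_
      rw [TensorProduct.smul_tmul', smul_eq_mul, mul_one, TensorProduct.smul_tmul]
    | add y z hy hz => simp only [map_add, add_smul, Finset.sum_add_distrib, hy, hz]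
  · simp [hg, hf, ← IsScalarTower.algebraMap_apply, Algebra.smul_def]

end order

/-! ### Descent of the generic determinant to the base ring. -/

/-- Polynomial rings over a field are integrally closed, so `F` and `H` divide each other and differ
by a constant, which the value at `v` fixes. This rigidity yields both Galois invariance and
independence of the splitting. -/
theorem MvPolynomial.eq_of_pow_eq_pow {σ ℓ : Type*} [Field ℓ] {n : ℕ} (hn : n ≠ 0)
    {F H : MvPolynomial σ ℓ} (h : F ^ n = H ^ n) {v : σ → ℓ} (hF : MvPolynomial.eval v F = 1)
    (hH : MvPolynomial.eval v H = 1) : F = H := by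
  have h1 : F ∣ H := (IsIntegrallyClosed.pow_dvd_pow_iff hn).1 h.dvd
  have h2 : H ∣ F := (IsIntegrallyClosed.pow_dvd_pow_iff hn).1 h.symm.dvd
  obtain ⟨u, hu⟩ := associated_of_dvd_dvd h1 h2
  obtain ⟨r, -, hr⟩ := MvPolynomial.isUnit_iff_eq_C_of_isReduced.1 u.isUnit
  have := congrArg (MvPolynomial.eval v) hu
  rw [map_mul, hF, hH, one_mul, hr, MvPolynomial.eval_C] at this
  rw [← hu, hr, this, map_one, mul_one]

namespace FiniteDualBasis

section

variable {R M C C' : Type*} [CommRing R] [Ring M] [Algebra R M] [CommRing C] [Algebra R C]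
  [CommRing C'] [Algebra R C'] {N : ℕ} (D : FiniteDualBasis R M N)

/-- The matrix of the right multiplication by the point `v`, transported to `C ^ N` and extended by
the identity. -/
def mulRightMatrix (v : Fin N → C) : Matrix (Fin N) (Fin N) C :=
  Matrix.of fun i j => (if i = j then 1 else 0) - algebraMap R C (D.f i (D.e j)) +
    ∑ l, algebraMap R C (D.f i (D.e j * D.e l)) * v l

theorem map_mulRightMatrix (h : C →ₐ[R] C') (v : Fin N → C) :
    (D.mulRightMatrix v).map h = D.mulRightMatrix fun j => h (v j) := by
  ext i j
  simp [mulRightMatrix, apply_ite h]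

theorem coord_point_apply (v : Fin N → C) (i : Fin N) :
    D.coord (D.point v) i = ∑ j, algebraMap R C (D.f i (D.e j)) * v j := by
  rw [coord, D.evalAt_point, D.toPoly_ι]
  simp [Algebra.smul_def]

theorem coord_point_mul_point (v v' : Fin N → C) (i : Fin N) :
    D.coord (D.point v * D.point v') i =
      ∑ j, ∑ l, algebraMap R C (D.f i (D.e j * D.e l)) * (v j * v' l) := by
  have h : ∀ m m' : C ⊗[R] M, D.coord (m + m') i = D.coord m i + D.coord m' i :=
    fun m m' => by rw [D.coord_add]; rfl
  let c : C ⊗[R] M →+ C := AddMonoidHom.mk' (fun m => D.coord m i) h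
  change c _ = _
  simp only [point, Finset.sum_mul_sum, map_sum, Algebra.TensorProduct.tmul_mul_tmul]
  refine Finset.sum_congr rfl fun j _ => Finset.sum_congr rfl fun l _ => ?_
  exact (D.coord_tmul _ _ _).trans (Algebra.smul_def _ _)

/-- The matrix represents `1 - i p + i ρ p`, with `p = point`, `i = coord` its section, and `ρ` the
right multiplication: `ρ` on the summand `C ⊗ M`, the identity on the kernel of `p`. -/
theorem mulRightMatrix_mulVec (v w : Fin N → C) :
    D.mulRightMatrix v *ᵥ w = w - D.coord (D.point w) + D.coord (D.point w * D.point v) := by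
  funext i
  simp only [Pi.add_apply, Pi.sub_apply, coord_point_mul_point, coord_point_apply, mulRightMatrix,
    Matrix.mulVec, dotProduct, Matrix.of_apply, add_mul, sub_mul, Finset.sum_add_distrib,
    Finset.sum_sub_distrib, Finset.sum_mul]
  congr 1
  · simp
  · exact Finset.sum_congr rfl fun j _ => Finset.sum_congr rfl fun l _ => by ring

/-- Solving the linear system with right-hand side the coordinates of `1` and applying `point`,
which kills `w - coord (point w)`, leaves a left inverse of `m`. -/
theorem exists_mul_eq_one {m : C ⊗[R] M} (h : IsUnit (D.mulRightMatrix (D.coord m)).det) :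
    ∃ y, y * m = 1 := by
  refine ⟨D.point ((D.mulRightMatrix (D.coord m))⁻¹ *ᵥ D.coord 1), ?_⟩
  set w := (D.mulRightMatrix (D.coord m))⁻¹ *ᵥ D.coord 1
  have h1 : D.mulRightMatrix (D.coord m) *ᵥ w = D.coord 1 := by
    rw [Matrix.mulVec_mulVec, Matrix.mul_nonsing_inv _ h, Matrix.one_mulVec]
  rw [mulRightMatrix_mulVec] at h1
  have h2 : D.point (w - D.coord (D.point w) + D.coord (D.point w * D.point (D.coord m))) = 1 := by
    rw [h1, point_coord]
  have h3 : D.point (w - D.coord (D.point w)) = 0 := by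
    have := D.point_add (w - D.coord (D.point w)) (D.coord (D.point w))
    rwa [sub_add_cancel, point_coord, right_eq_add] at this
  rwa [point_add, h3, zero_add, point_coord, point_coord] at h2

end

variable {R : Type u} {k : Type v} {A : Type w} [CommRing R] [IsDomain R] [Field k] [Algebra R k]
  [IsFractionRing R k] [Ring A] [Algebra k A] [Algebra R A] [IsScalarTower R k A]
  {Λ : Subalgebra R A} {N : ℕ} (D : FiniteDualBasis R Λ N)
  {ℓ : Type v} [Field ℓ] [Algebra k ℓ] [Algebra R ℓ] [IsScalarTower R k ℓ] {n : ℕ}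
  (φ : ℓ ⊗[k] A ≃ₐ[ℓ] Matrix (Fin n) (Fin n) ℓ)

/-- The matrix `φ y`, where `y` is the point of `B ⊗ Λ` with coordinates `v`. -/
def splitMatrix {B : Type*} [CommRing B] [Algebra ℓ B] (v : Fin N → B) :
    Matrix (Fin n) (Fin n) B :=
  ∑ j, v j • (φ (1 ⊗ₜ (D.e j : A))).map (algebraMap ℓ B)

/-- The determinant of the generic element of `Λ` in a splitting. -/
noncomputable def genericDet : MvPolynomial (Fin N) ℓ :=
  (D.splitMatrix φ (MvPolynomial.X : Fin N → MvPolynomial (Fin N) ℓ)).det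

omit [IsDomain R] [Algebra R k] [IsFractionRing R k] [IsScalarTower R k A] [Algebra R ℓ] in
theorem aeval_genericDet {B : Type*} [CommRing B] [Algebra ℓ B] (v : Fin N → B) :
    MvPolynomial.aeval v (D.genericDet φ) = (D.splitMatrix φ v).det := by
  rw [genericDet, AlgHom.map_det]
  congr 1
  ext i j
  simp [splitMatrix, Matrix.sum_apply]

omit [IsDomain R] [Algebra R k] [IsFractionRing R k] [IsScalarTower R k A] [Algebra R ℓ] in
theorem splitMatrix_self (v : Fin N → ℓ) :
    D.splitMatrix φ v = ∑ j, v j • φ (1 ⊗ₜ (D.e j : A)) := by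
  ext i j
  simp [splitMatrix, Matrix.sum_apply]

omit [IsDomain R] [IsFractionRing R k] in
theorem splittingHom_tmul (l : ℓ) (a : Λ) :
    splittingHom Λ φ (l ⊗ₜ a) = l • φ (1 ⊗ₜ (a : A)) := by
  refine (congrArg φ (Algebra.TensorProduct.lift_tmul _ _ (fun c a => by
    simp [Commute, SemiconjBy, Algebra.TensorProduct.tmul_mul_tmul]) _ _)).trans ?_
  rw [← map_smul]
  simp [TensorProduct.smul_tmul']

omit [IsDomain R] [IsFractionRing R k] in
theorem splitMatrix_eq_splittingHom (v : Fin N → ℓ) :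
    D.splitMatrix φ v = splittingHom Λ φ (D.point v) := by
  simp [point, splitMatrix_self, splittingHom_tmul]

omit [IsDomain R] [IsFractionRing R k] in
theorem splitMatrix_coord (m : ℓ ⊗[R] Λ) :
    D.splitMatrix φ (D.coord m) = splittingHom Λ φ m := by
  rw [splitMatrix_eq_splittingHom, point_coord]

omit [IsDomain R] [IsFractionRing R k] in
theorem splitMatrix_algebraMap {B : Type*} [CommRing B] [Algebra ℓ B] [Algebra R B]
    [IsScalarTower R ℓ B] (a : Λ) :
    D.splitMatrix φ (fun j => algebraMap R B (D.f j a)) =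
      (φ (1 ⊗ₜ (a : A))).map (algebraMap ℓ B) := by
  have h := D.splitMatrix_coord φ (1 ⊗ₜ a)
  have hc : D.coord ((1 : ℓ) ⊗ₜ[R] a) = fun j => algebraMap R ℓ (D.f j a) := by
    funext j
    rw [coord_tmul, Algebra.algebraMap_eq_smul_one]
  rw [splittingHom_tmul, one_smul, splitMatrix_self, hc] at h
  rw [← h, splitMatrix]
  ext i j
  simp only [Matrix.sum_apply, Matrix.smul_apply, Matrix.map_apply, smul_eq_mul, map_sum, map_mul,
    ← IsScalarTower.algebraMap_apply]

omit [IsDomain R] [IsFractionRing R k] in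
theorem eval_one_genericDet :
    MvPolynomial.eval (fun j => algebraMap R ℓ (D.f j 1)) (D.genericDet φ) = 1 := by
  have h := D.aeval_genericDet φ (fun j => algebraMap R ℓ (D.f j 1))
  rw [splitMatrix_algebraMap] at h
  rw [← MvPolynomial.coe_aeval_eq_eval, RingHom.coe_coe, h]
  simp [← Algebra.TensorProduct.one_def]

/-- A splitting turns right multiplication on `Λ` into right multiplication on `n × n` matrices, of
determinant `det ^ n`; the right-hand side, however, has coefficients in `R`. The identity is tested
at points, `ℓ` being infinite in characteristic zero. -/
theorem genericDet_pow [CharZero k] (hΛ : Submodule.span k (Λ : Set A) = ⊤) :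
    D.genericDet φ ^ n = MvPolynomial.map (algebraMap R ℓ) (D.mulRightMatrix MvPolynomial.X).det :=
        by
  have : CharZero ℓ := charZero_of_injective_algebraMap (algebraMap k ℓ).injective
  obtain ⟨Φ, h1, h2⟩ := D.exists_extension hΛ φ
  refine MvPolynomial.funext fun v => ?_
  rw [map_pow, MvPolynomial.eval_map, ← MvPolynomial.aeval_def, AlgHom.map_det,
    AlgHom.mapMatrix_apply, map_mulRightMatrix, ← MvPolynomial.coe_aeval_eq_eval, RingHom.coe_coe,
    aeval_genericDet, splitMatrix_self, ← Matrix.det_one_sub_add_mulRight _ Φ h1]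
  congr 1
  ext i j
  simp only [mulRightMatrix, Matrix.of_apply, h2, Matrix.mul_sum, map_sum, MvPolynomial.aeval_X,
    mul_smul_comm, map_smul, ← map_mul, Algebra.TensorProduct.tmul_mul_tmul, one_mul,
    ← MulMemClass.coe_mul]
  congr 1
  exact Finset.sum_congr rfl fun l _ => mul_comm _ _

/-- The reduced norm as a polynomial in the coordinates. -/
def IsNormPoly (k : Type v) [Field k] [Algebra R k] [Algebra k A] (F : MvPolynomial (Fin N) R) :
    Prop :=
  ∀ (ℓ : Type v) [Field ℓ] [Algebra k ℓ] [Algebra R ℓ] [IsScalarTower R k ℓ] (n : ℕ)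
    (φ : ℓ ⊗[k] A ≃ₐ[ℓ] Matrix (Fin n) (Fin n) ℓ),
    MvPolynomial.map (algebraMap R ℓ) F = D.genericDet φ

/-- Over the algebraic closure the coefficients of the generic determinant are integral over `R`, by
`genericDet_pow`, and fixed by the Galois group, by uniqueness of normalised `n`-th roots. -/
theorem exists_isNormPoly [CharZero k] [IsIntegrallyClosed R] [FiniteDimensional k A]
    [Algebra.IsCentral k A] [IsSimpleRing A] (hΛ : Submodule.span k (Λ : Set A) = ⊤) :
    ∃ F, D.IsNormPoly k F := by
  obtain ⟨n, hn, ⟨φ⟩⟩ := exists_splitting_algebraicClosure k A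
  let K := AlgebraicClosure k
  have hpow := D.genericDet_pow φ hΛ
  have hcoeff : ∀ d, (D.genericDet φ).coeff d ∈ Set.range (algebraMap R K) := by
    intro d
    let := MvPolynomial.algebraMvPolynomial (σ := Fin N) (R := R) (S := K)
    have hint : IsIntegral R ((D.genericDet φ).coeff d) := by
      refine MvPolynomial.isIntegral_iff_isIntegral_coeff.1 (IsIntegral.of_pow hn.bot_lt ?_) d
      rw [hpow]
      exact isIntegral_algebraMap (R := MvPolynomial (Fin N) R)
        (A := MvPolynomial (Fin N) K)
    have hσ : ∀ (σ : Gal(K/k)) (r : R), σ (algebraMap R K r) = algebraMap R K r := by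
      intro σ r
      rw [IsScalarTower.algebraMap_apply R k K, AlgEquiv.commutes]
    have hfix : ∀ σ : Gal(K/k), σ ((D.genericDet φ).coeff d) = (D.genericDet φ).coeff d := by
      intro σ
      have h1 : MvPolynomial.map (σ : K →+* K) (D.genericDet φ) = D.genericDet φ := by
        refine MvPolynomial.eq_of_pow_eq_pow hn (v := fun j => algebraMap R K (D.f j 1)) ?_ ?_
          (D.eval_one_genericDet φ)
        · rw [← map_pow, hpow, MvPolynomial.map_map]
          congr 2
          ext r
          exact hσ σ r
        · have h2 : ∀ r : R, σ (algebraMap R K r) = algebraMap R K r := by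
            intro r
            rw [IsScalarTower.algebraMap_apply R k K, AlgEquiv.commutes]
          rw [MvPolynomial.eval_map]
          have h3 := MvPolynomial.eval₂_comp_left (σ : K →+* K) (RingHom.id K)
            (fun j => algebraMap R K (D.f j 1)) (D.genericDet φ)
          have h4 : MvPolynomial.eval₂ (RingHom.id K) (fun j => algebraMap R K (D.f j 1))
            (D.genericDet φ) = 1 := D.eval_one_genericDet φ
          rw [h4, map_one] at h3
          rw [h3]
          congr 1
          ext j
          exact (hσ σ _).symm
      conv_rhs => rw [← h1]
      rw [MvPolynomial.coeff_map]
      rfl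
    -- Characteristic zero makes the algebraic closure Galois over `k`, so a fixed element lies in
    -- `k`.
    obtain ⟨c, hc⟩ := (InfiniteGalois.mem_range_algebraMap_iff_fixed _).2 hfix
    rw [← hc, isIntegral_algebraMap_iff (algebraMap k K).injective] at hint
    obtain ⟨r, rfl⟩ := IsIntegrallyClosed.isIntegral_iff.1 hint
    exact ⟨r, by rw [← hc, ← IsScalarTower.algebraMap_apply]⟩
  obtain ⟨F, hF⟩ : D.genericDet φ ∈ Set.range (MvPolynomial.map (algebraMap R K)) :=
    MvPolynomial.mem_range_map_iff_coeffs_subset.2 (by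
      intro c hc
      obtain ⟨d, -, rfl⟩ := MvPolynomial.mem_coeffs_iff.1 hc
      exact hcoeff d)
  have hinj : Function.Injective (algebraMap R K) := by
    rw [IsScalarTower.algebraMap_eq R k K]
    exact (algebraMap k K).injective.comp (IsFractionRing.injective R k)
  have hFn : F ^ n = (D.mulRightMatrix MvPolynomial.X).det := by
    refine MvPolynomial.map_injective _ hinj ?_
    rw [map_pow, ← hpow]
    exact congrArg (· ^ n) hF
  have hF1 : MvPolynomial.eval (fun j => D.f j 1) F = 1 := by
    refine hinj ?_
    rw [map_one, ← D.eval_one_genericDet φ, ← hF, MvPolynomial.eval_map,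
      MvPolynomial.eval, MvPolynomial.coe_eval₂Hom, MvPolynomial.eval₂_comp_left]
    rfl
  -- For another splitting the degree is the same, since its square is the dimension of `A`, and
  -- both polynomials are normalised `n`-th roots of the same determinant.
  refine ⟨F, fun ℓ _ _ _ _ n' φ' => ?_⟩
  have hnn : n' = n := by
    have := (finrank_eq_sq_of_splitting φ').symm.trans (finrank_eq_sq_of_splitting φ)
    exact Nat.pow_left_injective two_ne_zero this
  subst hnn
  refine MvPolynomial.eq_of_pow_eq_pow hn (v := fun j => algebraMap R ℓ (D.f j 1)) ?_ ?_
    (D.eval_one_genericDet φ')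
  · rw [D.genericDet_pow φ' hΛ, ← hFn, map_pow]
  · rw [MvPolynomial.eval_map, ← map_one (algebraMap R ℓ), ← hF1, MvPolynomial.eval,
      MvPolynomial.coe_eval₂Hom, MvPolynomial.eval₂_comp_left]
    rfl

end FiniteDualBasis

/-! ### The reduced trace. -/

theorem trace_mulRight_eq {k A ℓ : Type*} [Field k] [Ring A] [Algebra k A] [FiniteDimensional k A]
    [Field ℓ] [Algebra k ℓ] {n : ℕ} (φ : ℓ ⊗[k] A ≃ₐ[ℓ] Matrix (Fin n) (Fin n) ℓ) (a : A) :
    algebraMap k ℓ (LinearMap.trace k A (LinearMap.mulRight k a)) =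
      n * Matrix.trace (φ (1 ⊗ₜ[k] a)) := by
  have h1 := Matrix.trace_mulRight (φ (1 ⊗ₜ[k] a))
  rw [Fintype.card_fin] at h1
  rw [← h1, ← LinearMap.trace_baseChange, ← LinearMap.trace_conj' _ φ.toLinearEquiv]
  congr 1
  refine LinearMap.ext fun Z => ?_
  obtain ⟨y, rfl⟩ := φ.surjective Z
  rw [LinearEquiv.conj_apply_apply, LinearMap.mulRight_apply, ← map_mul]
  have : φ.toLinearEquiv.symm (φ y) = y := φ.symm_apply_apply y
  rw [this]
  refine congrArg φ ?_
  clear this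
  induction y with
  | zero => simp
  | tmul l b => simp
  | add y z hy hz => rw [map_add, hy, hz, add_mul]

/-- The trace of right multiplication is `n` times the matrix trace in every splitting, and `n` is
invertible in characteristic zero. -/
theorem existsUnique_isReducedTrace (k : Type v) (A : Type w) [Field k] [CharZero k] [Ring A]
    [Algebra k A] [FiniteDimensional k A] [Algebra.IsCentral k A] [IsSimpleRing A] :
    ∃! t : A →ₗ[k] k, IsReducedTrace k A t := by
  obtain ⟨n, hn, ⟨φ⟩⟩ := exists_splitting_algebraicClosure k A
  refine ⟨(n : k)⁻¹ • (LinearMap.trace k A ∘ₗ (LinearMap.mul k A).flip), ?_, fun t ht => ?_⟩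
  · intro ℓ _ _ n' φ' a
    have hnn : n' = n := Nat.pow_left_injective two_ne_zero
      ((finrank_eq_sq_of_splitting φ').symm.trans (finrank_eq_sq_of_splitting φ))
    subst hnn
    have : CharZero ℓ := charZero_of_injective_algebraMap (algebraMap k ℓ).injective
    have h1 := trace_mulRight_eq φ' a
    change algebraMap k ℓ ((n' : k)⁻¹ * LinearMap.trace k A (LinearMap.mulRight k a)) = _
    rw [map_mul, h1, map_inv₀, map_natCast, inv_mul_cancel_left₀ (Nat.cast_ne_zero.2 hn)]
  · ext a
    refine (algebraMap k (AlgebraicClosure k)).injective ?_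
    have h1 := trace_mulRight_eq φ a
    change _ = algebraMap k _ ((n : k)⁻¹ * LinearMap.trace k A (LinearMap.mulRight k a))
    have : CharZero (AlgebraicClosure k) :=
      charZero_of_injective_algebraMap (algebraMap k (AlgebraicClosure k)).injective
    rw [map_mul, h1, map_inv₀, map_natCast, inv_mul_cancel_left₀ (Nat.cast_ne_zero.2 hn), ht]

theorem isReducedTrace_reducedTrace (k : Type v) (A : Type w) [Field k] [CharZero k] [Ring A]
    [Algebra k A] [FiniteDimensional k A] [Algebra.IsCentral k A] [IsSimpleRing A] :
    IsReducedTrace k A (reducedTrace k A) :=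
  Classical.epsilon_spec (existsUnique_isReducedTrace k A).exists

/-! ### Existence and properties of the reduced norm. -/

section

variable {R : Type u} {k : Type v} {A : Type w} [CommRing R] [IsDomain R] [Field k] [CharZero k]
  [Algebra R k] [IsFractionRing R k] [Ring A] [Algebra k A] [FiniteDimensional k A]
  [Algebra.IsCentral k A] [IsSimpleRing A] [Algebra R A] [IsScalarTower R k A]
  {Λ : Subalgebra R A} {N : ℕ} (D : FiniteDualBasis R Λ N)

include k in
omit [IsDomain R] [CharZero k] in
theorem faithfulSMul_algebraicClosure : FaithfulSMul R (AlgebraicClosure k) := by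
  rw [faithfulSMul_iff_algebraMap_injective, IsScalarTower.algebraMap_eq R k]
  exact (algebraMap k _).injective.comp (IsFractionRing.injective R k)

theorem existsUnique_isReducedNorm [IsIntegrallyClosed R] [Module.Finite R Λ]
    [Module.Projective R Λ] (hΛ : Submodule.span k (Λ : Set A) = ⊤) :
    ∃! ν : SymmetricAlgebra R (Module.Dual R Λ), IsReducedNorm R k A Λ ν := by
  obtain ⟨N, ⟨D⟩⟩ := exists_finiteDualBasis R Λ
  obtain ⟨F, hF⟩ := D.exists_isNormPoly (k := k) hΛ
  refine ⟨D.ofPoly F, ?_, fun ν hν => ?_⟩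
  · intro ℓ _ _ _ _ n φ y
    rw [D.evalAt_ofPoly, ← D.splitMatrix_coord, ← FiniteDualBasis.aeval_genericDet, ← hF,
      MvPolynomial.aeval_map_algebraMap]
  · obtain ⟨n, hn, ⟨φ⟩⟩ := exists_splitting_algebraicClosure k A
    have := faithfulSMul_algebraicClosure (R := R) (k := k)
    refine eq_of_evalAt_eq (ℓ := AlgebraicClosure k) fun y => ?_
    rw [hν _ n φ, D.evalAt_ofPoly, ← D.splitMatrix_coord, ← FiniteDualBasis.aeval_genericDet, ← hF,
      MvPolynomial.aeval_map_algebraMap]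

theorem isReducedNorm_reducedNorm [IsIntegrallyClosed R] [Module.Finite R Λ]
    [Module.Projective R Λ] (hΛ : Submodule.span k (Λ : Set A) = ⊤) :
    IsReducedNorm R k A Λ (reducedNorm R k A Λ) :=
  Classical.epsilon_spec (existsUnique_isReducedNorm hΛ).exists

namespace IsReducedNorm

variable {ν : SymmetricAlgebra R (Module.Dual R Λ)} (hν : IsReducedNorm R k A Λ ν)
include hν

omit [FiniteDimensional k A] [Algebra.IsCentral k A] [IsSimpleRing A] in
omit [IsDomain R] [IsFractionRing R k] in
theorem isNormPoly_toPoly : D.IsNormPoly k (D.toPoly ν) := by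
  intro ℓ _ _ _ _ n φ
  have : CharZero ℓ := charZero_of_injective_algebraMap (algebraMap k ℓ).injective
  refine MvPolynomial.funext fun v => ?_
  rw [MvPolynomial.eval_map, ← MvPolynomial.aeval_def, ← D.evalAt_point, hν,
    ← MvPolynomial.coe_aeval_eq_eval, RingHom.coe_coe, D.aeval_genericDet,
    D.splitMatrix_eq_splittingHom]

omit hν in
omit [IsDomain R] [IsSimpleRing A] in
theorem evalAt_one_eq_algebraMap {C : Type*} [CommRing C] [Algebra R C] :
    evalAt (1 : C ⊗[R] Λ) ν = algebraMap R C (evalAt (1 : R ⊗[R] Λ) ν) := by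
  have := evalAt_rTensor (Algebra.ofId R C) (1 : R ⊗[R] Λ) ν
  rw [Algebra.TensorProduct.one_def, LinearMap.rTensor_tmul] at this
  simpa [Algebra.TensorProduct.one_def] using this

omit [IsDomain R] [CharZero k] in
theorem evalAt_one {C : Type*} [CommRing C] [Algebra R C] : evalAt (1 : C ⊗[R] Λ) ν = 1 := by
  obtain ⟨n, hn, ⟨φ⟩⟩ := exists_splitting_algebraicClosure k A
  have := faithfulSMul_algebraicClosure (R := R) (k := k)
  rw [evalAt_one_eq_algebraMap, ← map_one (algebraMap R C)]
  congr 1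
  refine FaithfulSMul.algebraMap_injective R (AlgebraicClosure k) ?_
  rw [← evalAt_one_eq_algebraMap, hν _ n φ, map_one, map_one, Matrix.det_one]

omit [IsDomain R] [CharZero k] in
-- It suffices to treat the universal pair of points, over a polynomial ring in `2N` variables;
-- there the identity is checked at points of the algebraic closure, where it is multiplicativity of
-- `det`.
theorem evalAt_mul [Module.Finite R Λ] [Module.Projective R Λ] {C : Type*} [CommRing C]
    [Algebra R C] (g h : C ⊗[R] Λ) : evalAt (g * h) ν = evalAt g ν * evalAt h ν := by
  obtain ⟨N, ⟨D⟩⟩ := exists_finiteDualBasis R Λ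
  obtain ⟨n, hn, ⟨φ⟩⟩ := exists_splitting_algebraicClosure k A
  have := faithfulSMul_algebraicClosure (R := R) (k := k)
  let gU : MvPolynomial (Fin N ⊕ Fin N) R ⊗[R] Λ := D.point fun j => MvPolynomial.X (Sum.inl j)
  let hU : MvPolynomial (Fin N ⊕ Fin N) R ⊗[R] Λ := D.point fun j => MvPolynomial.X (Sum.inr j)
  have key : evalAt (gU * hU) ν = evalAt gU ν * evalAt hU ν := by
    refine MvPolynomial.map_injective _ (FaithfulSMul.algebraMap_injective R (AlgebraicClosure k))
      (MvPolynomial.funext fun p => ?_)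
    rw [MvPolynomial.eval_map, MvPolynomial.eval_map, ← MvPolynomial.aeval_def,
      ← MvPolynomial.aeval_def, map_mul]
    have hev := fun y => evalAt_rTensor (M := Λ) (MvPolynomial.aeval (R := R) p) y ν
    rw [← hev, ← hev, ← hev, hν _ n φ, hν _ n φ, hν _ n φ, ← Matrix.det_mul, ← map_mul]
    congr 2
    exact map_mul (Algebra.TensorProduct.map (MvPolynomial.aeval p) (AlgHom.id R Λ)) gU hU
  let q : MvPolynomial (Fin N ⊕ Fin N) R →ₐ[R] C := MvPolynomial.aeval (Sum.elim (D.coord g)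
      (D.coord h))
  have hg : Algebra.TensorProduct.map q (AlgHom.id R Λ) gU = g := by
    conv_rhs => rw [← D.point_coord g]
    simp [gU, FiniteDualBasis.point, q]
  have hh : Algebra.TensorProduct.map q (AlgHom.id R Λ) hU = h := by
    conv_rhs => rw [← D.point_coord h]
    simp [hU, FiniteDualBasis.point, q]
  have h1 := congrArg q key
  rw [map_mul, ← evalAt_rTensor, ← evalAt_rTensor, ← evalAt_rTensor] at h1
  rw [← hg, ← hh, ← map_mul]
  exact h1

omit [FiniteDimensional k A] [Algebra.IsCentral k A] [IsSimpleRing A] in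
theorem det_mulRightMatrix (hΛ : Submodule.span k (Λ : Set A) = ⊤) {n : ℕ}
    (φ : AlgebraicClosure k ⊗[k] A ≃ₐ[AlgebraicClosure k]
      Matrix (Fin n) (Fin n) (AlgebraicClosure k))
    {C : Type*} [CommRing C] [Algebra R C] (m : C ⊗[R] Λ) :
    (D.mulRightMatrix (D.coord m)).det = evalAt m ν ^ n := by
  have := faithfulSMul_algebraicClosure (R := R) (k := k)
  have h1 : (D.mulRightMatrix MvPolynomial.X).det = D.toPoly ν ^ n := by
    refine MvPolynomial.map_injective _ (FaithfulSMul.algebraMap_injective R (AlgebraicClosure k))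
        ?_
    rw [← D.genericDet_pow φ hΛ, map_pow, isNormPoly_toPoly D hν _ n φ]
  have h2 := congrArg (MvPolynomial.aeval (D.coord m)) h1
  rw [AlgHom.map_det, AlgHom.mapMatrix_apply, D.map_mulRightMatrix, map_pow, ← D.evalAt_point,
    D.point_coord] at h2
  simpa using h2

theorem isUnit_of_isUnit_evalAt [Module.Finite R Λ] [Module.Projective R Λ]
    (hΛ : Submodule.span k (Λ : Set A) = ⊤) {C : Type*} [CommRing C] [Algebra R C]
    {m : C ⊗[R] Λ} (hm : IsUnit (evalAt m ν)) : IsUnit m := by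
  obtain ⟨N, ⟨D⟩⟩ := exists_finiteDualBasis R Λ
  obtain ⟨n, hn, ⟨φ⟩⟩ := exists_splitting_algebraicClosure k A
  have key : ∀ m : C ⊗[R] Λ, IsUnit (evalAt m ν) → ∃ y, y * m = 1 := fun m hm =>
    D.exists_mul_eq_one (by rw [det_mulRightMatrix D hν hΛ φ]; exact hm.pow n)
  obtain ⟨y, hy⟩ := key m hm
  have hy' : IsUnit (evalAt y ν) := by
    refine IsUnit.of_mul_eq_one (evalAt m ν) ?_
    rw [← hν.evalAt_mul, hy, hν.evalAt_one]
  -- The left inverse `y` has unit norm as well, so it has a left inverse `z`, and `z = z (y m) =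
  -- m`.
  obtain ⟨z, hz⟩ := key y hy'
  have : z = m := by rw [← mul_one z, ← hy, ← mul_assoc, hz, one_mul]
  exact ⟨⟨m, y, this ▸ hz, hy⟩, rfl⟩

omit [FiniteDimensional k A] [Algebra.IsCentral k A] [IsSimpleRing A] in
omit [IsDomain R] [IsFractionRing R k] in
-- Used twice: `p = 1`, `q = X` gives the expansion of the norm at `1`, and `p = X`, `q = -1` the
-- reduced characteristic polynomial.
theorem map_evalAt_pencil {ℓ : Type v} [Field ℓ] [Algebra k ℓ] [Algebra R ℓ] [IsScalarTower R k ℓ]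
    [Module.Finite R Λ] [Module.Projective R Λ] {n : ℕ}
    (φ : ℓ ⊗[k] A ≃ₐ[ℓ] Matrix (Fin n) (Fin n) ℓ) (a : Λ) (p q : Polynomial R) :
    (evalAt (p ⊗ₜ[R] 1 + q ⊗ₜ[R] a) ν).map (algebraMap R ℓ) =
      (p.map (algebraMap R ℓ) • 1 +
        q.map (algebraMap R ℓ) • (φ (1 ⊗ₜ (a : A))).map Polynomial.C).det := by
  obtain ⟨N, ⟨D⟩⟩ := exists_finiteDualBasis R Λ
  let h : Polynomial R →ₐ[R] Polynomial ℓ := Polynomial.mapAlgHom (Algebra.ofId R ℓ)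
  have hh : ∀ p, h p = p.map (algebraMap R ℓ) := fun p => rfl
  rw [← hh, ← D.point_coord (p ⊗ₜ[R] 1 + q ⊗ₜ[R] a), D.evalAt_point,
    MvPolynomial.aeval_def, ← AlgHom.coe_toRingHom, MvPolynomial.hom_eval₂]
  have h1 := D.aeval_genericDet φ (fun j => h (D.coord (p ⊗ₜ[R] 1 + q ⊗ₜ[R] a) j))
  rw [← isNormPoly_toPoly D hν _ n φ, MvPolynomial.aeval_map_algebraMap] at h1
  have h2 : (h : Polynomial R →+* Polynomial ℓ).comp (algebraMap R (Polynomial R)) = algebraMap R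
      (Polynomial ℓ) :=
    h.comp_algebraMap
  rw [h2]
  refine h1.trans ?_
  congr 1
  have e1 := D.splitMatrix_algebraMap φ (B := Polynomial ℓ) 1
  have e2 := D.splitMatrix_algebraMap φ (B := Polynomial ℓ) a
  have e3 : (φ (1 ⊗ₜ ((1 : Λ) : A))).map (algebraMap ℓ (Polynomial ℓ)) = 1 := by
    simp [← Algebra.TensorProduct.one_def]
  rw [e3] at e1
  rw [← Polynomial.algebraMap_eq, ← e1, ← e2]
  simp only [FiniteDualBasis.splitMatrix, Finset.smul_sum, ← Finset.sum_add_distrib, smul_smul,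
    ← add_smul]
  refine Finset.sum_congr rfl fun j _ => ?_
  congr 1
  rw [D.coord_add, Pi.add_apply, D.coord_tmul, D.coord_tmul, map_add, map_smul, map_smul, hh, hh,
    Algebra.smul_def, Algebra.smul_def, mul_comm, mul_comm (algebraMap R _ (D.f j a))]

omit [IsDomain R] in
/-- The expansion of the reduced norm at `1`. -/
theorem evalAt_one_add_X [Module.Finite R Λ] [Module.Projective R Λ] (a : Λ) :
    ∃ (r : R) (Q : Polynomial R), algebraMap R k r = reducedTrace k A a ∧
      evalAt ((1 : Polynomial R ⊗[R] Λ) + Polynomial.X ⊗ₜ[R] a) ν = 1 + Polynomial.C r *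
          Polynomial.X +
        Q * Polynomial.X ^ 2 := by
  obtain ⟨n, hn, ⟨φ⟩⟩ := exists_splitting_algebraicClosure k A
  have := faithfulSMul_algebraicClosure (R := R) (k := k)
  have hinj := FaithfulSMul.algebraMap_injective R (AlgebraicClosure k)
  have h1 := hν.map_evalAt_pencil φ a 1 Polynomial.X
  rw [← Algebra.TensorProduct.one_def, Polynomial.map_one, Polynomial.map_X, one_smul] at h1
  set P := evalAt ((1 : Polynomial R ⊗[R] Λ) + Polynomial.X ⊗ₜ[R] a) ν
  have h0 : P.coeff 0 = 1 := by
    refine hinj ?_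
    rw [← Polynomial.coeff_map, h1, Polynomial.coeff_zero_eq_eval_zero, ←
        Polynomial.coe_evalRingHom,
      RingHom.map_det, map_one]
    refine (congrArg Matrix.det ?_).trans (Matrix.det_one (n := Fin n))
    ext i j
    by_cases hij : i = j <;> simp [Matrix.one_apply, hij]
  refine ⟨P.coeff 1, P.divX.divX, ?_, ?_⟩
  · refine (algebraMap k (AlgebraicClosure k)).injective ?_
    rw [← IsScalarTower.algebraMap_apply, isReducedTrace_reducedTrace k A _ n φ,
      ← Polynomial.coeff_map, h1, Matrix.coeff_det_one_add_X_smul_one]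
  · conv_lhs => rw [← Polynomial.divX_mul_X_add P, ← Polynomial.divX_mul_X_add P.divX, h0,
      Polynomial.coeff_divX]
    simp only [zero_add, map_one]
    ring

omit [IsDomain R] in
theorem evalAt_one_add_tmul [Module.Finite R Λ] [Module.Projective R Λ] {a : Λ}
    (ha : reducedTrace k A a = 1) {C : Type*} [CommRing C] [Algebra R C] {t : C} (ht : t ^ 2 = 0) :
    evalAt ((1 : C ⊗[R] Λ) + t ⊗ₜ[R] a) ν = 1 + t := by
  obtain ⟨r, Q, hr, hQ⟩ := hν.evalAt_one_add_X a
  have hr1 : r = 1 := IsFractionRing.injective R k (by rw [hr, ha, map_one])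
  have h1 := evalAt_rTensor (Polynomial.aeval (R := R) t) ((1 : Polynomial R ⊗[R] Λ) + Polynomial.X
      ⊗ₜ[R] a) ν
  rw [hQ, hr1] at h1
  rw [Algebra.TensorProduct.one_def] at h1 ⊢
  simpa [ht] using h1

end IsReducedNorm

end

/-! ### Representability and smoothness of the special linear group. -/

/-- For a retract of a polynomial ring, the kernel of the retraction is generated by the differences
between the variables and their images under the associated idempotent endomorphism. -/
theorem SymmetricAlgebra.finitePresentation_dual (R M : Type*) [CommRing R] [AddCommGroup M]
    [Module R M] [Module.Finite R M] [Module.Projective R M] :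
    Algebra.FinitePresentation R (SymmetricAlgebra R (Module.Dual R M)) := by
  classical
  obtain ⟨N, ⟨D⟩⟩ := exists_finiteDualBasis R M
  refine Algebra.FinitePresentation.of_surjective D.ofPoly_surjective ?_
  let r : Fin N → MvPolynomial (Fin N) R := fun j =>
    MvPolynomial.X j - D.toPoly (D.ofPoly (MvPolynomial.X j))
  refine ⟨Finset.univ.image r, le_antisymm ?_ ?_⟩
  · rw [Ideal.span_le]
    intro x hx
    obtain ⟨j, -, rfl⟩ := Finset.mem_image.1 hx
    change D.ofPoly _ = 0
    rw [map_sub, D.ofPoly_toPoly, sub_self]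
  · intro F hF
    have hF : D.ofPoly F = 0 := hF
    have h1 : ((Ideal.Quotient.mkₐ R (Ideal.span (Finset.univ.image r : Set _))).comp
        (D.toPoly.comp D.ofPoly)) = Ideal.Quotient.mkₐ R _ := by
      ext j
      symm
      refine Ideal.Quotient.eq.2 (Ideal.subset_span ?_)
      simp only [Finset.coe_image, Finset.coe_univ, Set.image_univ]
      exact ⟨j, rfl⟩
    have h2 := DFunLike.congr_fun h1 F
    simp only [AlgHom.comp_apply, hF, map_zero] at h2
    exact Ideal.Quotient.eq_zero_iff_mem.1 h2.symm

section

variable {R : Type u} {k : Type v} {A : Type w} [CommRing R] [IsDomain R] [Field k] [CharZero k]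
  [Algebra R k] [IsFractionRing R k] [Ring A] [Algebra k A] [FiniteDimensional k A]
  [Algebra.IsCentral k A] [IsSimpleRing A] [Algebra R A] [IsScalarTower R k A]
  {Λ : Subalgebra R A} [IsIntegrallyClosed R] [Module.Finite R Λ] [Module.Projective R Λ]

/-- An arbitrary lift `m` has norm `1 + ε` with `ε ∈ I`. The factor `1 - ε a` is trivial modulo `I`
and has norm `1 - ε`, and `(1 + ε) (1 - ε) = 1`. -/
theorem exists_evalAt_eq_one_of_sq_zero (hΛ : Submodule.span k (Λ : Set A) = ⊤)
    {a : Λ} (ha : reducedTrace k A a = 1) {C : Type*} [CommRing C] [Algebra R C] {I : Ideal C}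
    (hI : I ^ 2 = ⊥) (m' : (C ⧸ I) ⊗[R] Λ) (hm' : evalAt m' (reducedNorm R k A Λ) = 1) :
    ∃ m : C ⊗[R] Λ, evalAt m (reducedNorm R k A Λ) = 1 ∧
      LinearMap.rTensor Λ (Ideal.Quotient.mkₐ R I).toLinearMap m = m' := by
  have hν := isReducedNorm_reducedNorm (R := R) (k := k) hΛ
  set ν := reducedNorm R k A Λ
  obtain ⟨m, rfl⟩ := LinearMap.rTensor_surjective Λ
    (g := (Ideal.Quotient.mkₐ R I).toLinearMap) (Ideal.Quotient.mkₐ_surjective R I) m'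
  rw [evalAt_rTensor, ← map_one (Ideal.Quotient.mkₐ R I)] at hm'
  set ε := evalAt m ν - 1
  have hε : ε ∈ I := Ideal.Quotient.eq.1 hm'
  have hε2 : ε * ε = 0 := by
    have : ε * ε ∈ I ^ 2 := by rw [sq]; exact Ideal.mul_mem_mul hε hε
    simpa [hI] using this
  have hmν : evalAt m ν = 1 + ε := by simp [ε]
  refine ⟨m * (1 + (-ε) ⊗ₜ a), ?_, ?_⟩
  · rw [hν.evalAt_mul, hν.evalAt_one_add_tmul ha (by rw [neg_sq, sq, hε2]), hmν]
    linear_combination -hε2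
  · change Algebra.TensorProduct.map (Ideal.Quotient.mkₐ R I) (AlgHom.id R Λ) _ =
      Algebra.TensorProduct.map (Ideal.Quotient.mkₐ R I) (AlgHom.id R Λ) _
    have h0 : Ideal.Quotient.mkₐ R I (-ε) = 0 :=
      Ideal.Quotient.eq_zero_iff_mem.2 (I.neg_mem hε)
    rw [map_mul, map_add, Algebra.TensorProduct.map_tmul, h0, TensorProduct.zero_tmul, map_one,
      add_zero, mul_one]

theorem SLCoord_representable (hΛ : Submodule.span k (Λ : Set A) = ⊤) (C : Type*) [CommRing C]
    [Algebra R C] :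
    (∀ g ∈ SLPoints R k A Λ C, ∃! p : SLCoord R k A Λ →ₐ[R] C,
      p.comp (Ideal.Quotient.mkₐ R _) = evalAt (g : C ⊗[R] Λ)) ∧
    (∀ p : SLCoord R k A Λ →ₐ[R] C, ∃! g : (C ⊗[R] Λ)ˣ, g ∈ SLPoints R k A Λ C ∧
      p.comp (Ideal.Quotient.mkₐ R _) = evalAt (g : C ⊗[R] Λ)) := by
  have hν := isReducedNorm_reducedNorm (R := R) (k := k) hΛ
  constructor
  · intro g hg
    refine ⟨Ideal.Quotient.liftₐ _ (evalAt (g : C ⊗[R] Λ)) ?_, ?_, fun p hp => ?_⟩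
    · intro s hs
      refine (Ideal.span_singleton_le_iff_mem
        (I := RingHom.ker (evalAt (g : C ⊗[R] Λ)))).2 ?_ hs
      rw [RingHom.mem_ker, map_sub, map_one, sub_eq_zero]
      exact hg
    · exact Ideal.Quotient.liftₐ_comp _ _ _
    · refine Ideal.Quotient.algHom_ext _ (hp.trans ?_)
      exact (Ideal.Quotient.liftₐ_comp _ _ _).symm
  · intro p
    obtain ⟨m, hm⟩ := evalAt_surjective (p.comp (Ideal.Quotient.mkₐ R _))
    have hm1 : evalAt m (reducedNorm R k A Λ) = 1 := by
      rw [hm, AlgHom.comp_apply, ← map_one p]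
      congr 1
      exact Ideal.Quotient.eq.2 (Ideal.subset_span rfl)
    -- The coordinate ring does not invert anything: norm one already forces the point to be a unit.
    obtain ⟨g, rfl⟩ := hν.isUnit_of_isUnit_evalAt hΛ (m := m) (by rw [hm1]; exact isUnit_one)
    refine ⟨g, ⟨hm1, hm.symm⟩, fun g' hg' => Units.ext (evalAt_injective ?_)⟩
    rw [hm, ← hg'.2]

theorem SLCoord_smooth (hΛ : Submodule.span k (Λ : Set A) = ⊤)
    {a : Λ} (ha : reducedTrace k A a = 1) : Algebra.Smooth R (SLCoord R k A Λ) where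
  formallySmooth := by
    refine Algebra.FormallySmooth.of_comp_surjective fun C _ _ I hI p => ?_
    obtain ⟨g, ⟨hg1, hg2⟩, -⟩ := (SLCoord_representable hΛ (C ⧸ I)).2 p
    obtain ⟨m, hm1, hm2⟩ := exists_evalAt_eq_one_of_sq_zero hΛ ha hI _ hg1
    have hν := isReducedNorm_reducedNorm (R := R) (k := k) hΛ
    obtain ⟨g', rfl⟩ := hν.isUnit_of_isUnit_evalAt hΛ (m := m) (by rw [hm1]; exact isUnit_one)
    obtain ⟨q, hq, -⟩ := (SLCoord_representable hΛ C).1 g' hm1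
    refine ⟨q, Ideal.Quotient.algHom_ext _ ?_⟩
    rw [hg2, AlgHom.comp_assoc, hq, ← hm2]
    exact (AlgHom.ext fun s => evalAt_rTensor _ _ s).symm
  finitePresentation := by
    have := SymmetricAlgebra.finitePresentation_dual R Λ
    exact Algebra.FinitePresentation.quotient (Submodule.fg_span_singleton _)

theorem isSmoothGroupSchemeSL_of_reducedTrace_eq_one (hΛ : Submodule.span k (Λ : Set A) = ⊤)
    {a : Λ} (ha : reducedTrace k A a = 1) : IsSmoothGroupSchemeSL.{u, v, w, x} R k A Λ where
  eq_ker C _ _ := by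
    have hν := isReducedNorm_reducedNorm (R := R) (k := k) hΛ
    let f : C ⊗[R] Λ →* C :=
      { toFun := fun m => evalAt m (reducedNorm R k A Λ)
        map_one' := hν.evalAt_one
        map_mul' := hν.evalAt_mul }
    refine ⟨Units.map f, fun g => rfl, ?_⟩
    ext g
    rw [SetLike.mem_coe, MonoidHom.mem_ker, Units.ext_iff]
    rfl
  representable C _ _ := SLCoord_representable hΛ C
  smooth := SLCoord_smooth hΛ ha
  lift C _ _ I hI g' hg' := by
    have := (SLCoord_smooth hΛ ha).formallySmooth
    obtain ⟨p, hp, -⟩ := (SLCoord_representable hΛ (C ⧸ I)).1 g' hg'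
    -- Formal smoothness lifts along every nilpotent ideal, not only along square-zero ones.
    obtain ⟨q, rfl⟩ := Algebra.FormallySmooth.exists_lift I hI p
    obtain ⟨g, ⟨hg1, hg2⟩, -⟩ := (SLCoord_representable hΛ C).2 q
    refine ⟨g, hg1, Units.ext (evalAt_injective ?_)⟩
    rw [← hp, AlgHom.comp_assoc, hg2]
    exact AlgHom.ext fun s => evalAt_rTensor _ _ s

end

/-! ### Finite simple modules and modules killed by their annihilators. -/

/-- By faithfulness `t ↦ (t s)_s` embeds `T` into a finite power of `S`, so `T` is semisimple and
isotypic. -/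
theorem IsSimpleRing.of_faithful_simple_finite (T S : Type*) [Ring T] [AddCommGroup S] [Module T S]
    [IsSimpleModule T S] [FaithfulSMul T S] [Finite S] : IsSimpleRing T ∧ Finite T := by
  have hT : Finite T := Finite.of_injective (fun t : T => fun s : S => t • s) fun a b h =>
    FaithfulSMul.eq_of_smul_eq_smul fun s : S => congrFun h s
  let f : T →ₗ[T] (S → S) := LinearMap.pi fun s => LinearMap.toSpanSingleton T S s
  have hf : Function.Injective f := fun a b h =>
    FaithfulSMul.eq_of_smul_eq_smul fun s : S => congrFun h s
  have hss : IsSemisimpleRing T := IsSemisimpleModule.of_injective f hf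
  have hnt : Nontrivial T := by
    have := IsSimpleModule.nontrivial T S
    exact Module.nontrivial T S
  have hiso : IsIsotypicOfType T (S → S) S := by
    intro m hm
    have := IsSimpleModule.nontrivial T m
    obtain ⟨y, hy⟩ := exists_ne (0 : m)
    obtain ⟨s, hs⟩ : ∃ s, (y : S → S) s ≠ 0 := by
      by_contra! h
      exact hy (Subtype.ext (funext h))
    let g : m →ₗ[T] S := LinearMap.proj s ∘ₗ m.subtype
    have hg : g ≠ 0 := fun h => hs (DFunLike.congr_fun h y)
    exact ⟨LinearEquiv.ofBijective g (LinearMap.bijective_of_ne_zero hg)⟩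
  exact ⟨(isSimpleRing_isArtinianRing_iff.2
    ⟨hss, (hiso.of_injective f hf).isIsotypic, hnt⟩).1, hT⟩

theorem IsSimpleRing.nonempty_linearEquiv_of_isSimpleModule (T S S' : Type*) [Ring T]
    [IsSimpleRing T] [IsArtinianRing T] [AddCommGroup S] [Module T S] [IsSimpleModule T S]
    [AddCommGroup S'] [Module T S'] [IsSimpleModule T S'] : Nonempty (S ≃ₗ[T] S') := by
  obtain ⟨I, ⟨e⟩⟩ := IsSemisimpleRing.exists_linearEquiv_ideal_of_isSimpleModule T S
  obtain ⟨I', ⟨e'⟩⟩ := IsSemisimpleRing.exists_linearEquiv_ideal_of_isSimpleModule T S'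
  have := IsSimpleModule.congr e.symm
  have := IsSimpleModule.congr e'.symm
  obtain ⟨g⟩ := IsSimpleRing.isIsotypic T T I' I
  exact ⟨e.trans (g.trans e'.symm)⟩

theorem IsSimpleRing.exists_linearEquiv_fun (T S Q : Type*) [Ring T] [IsSimpleRing T]
    [IsArtinianRing T] [AddCommGroup S] [Module T S] [IsSimpleModule T S] [AddCommGroup Q]
    [Module T Q] [Module.Finite T Q] : ∃ a : ℕ, Nonempty (Q ≃ₗ[T] (Fin a → S)) :=
  IsIsotypicOfType.linearEquiv_fun fun m _ => nonempty_linearEquiv_of_isSimpleModule T m S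

theorem finite_quotient_annihilator {L : Type*} (S : Type*) [Ring L] [AddCommGroup S] [Module L S]
    [Finite S] : Finite (L ⧸ Module.annihilator L S) :=
  Finite.of_injective (fun t : L ⧸ Module.annihilator L S =>
    Quotient.liftOn' t (fun l s => l • s) (fun a b h => by
      rw [Submodule.quotientRel_def, Module.mem_annihilator] at h
      funext s
      simpa [sub_smul, sub_eq_zero] using h s)) fun a b => by
    induction a using Quotient.inductionOn'
    induction b using Quotient.inductionOn'
    intro h
    refine (Submodule.Quotient.eq _).2 (Module.mem_annihilator.2 fun s => ?_)
    rw [sub_smul, sub_eq_zero]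
    exact congrFun h s

section simpleModule

variable {L : Type*} (S Q : Type*) [Ring L] [AddCommGroup S] [Module L S] [IsSimpleModule L S]
  [Finite S] [AddCommGroup Q] [Module L Q] [Finite Q]

/-- Modulo the annihilator, `L` becomes a finite simple ring, over which finite modules are powers
of `S`. If `a ≤ b`, the ring projects onto `Q`, which is then cyclic. Cardinalities thus decide
cyclicity. -/
theorem exists_linearEquiv_fun_of_annihilator
    (hQ : ∀ p ∈ Module.annihilator L S, ∀ q : Q, p • q = 0) :
    ∃ a b : ℕ, Nonempty (Q ≃+ (Fin a → S)) ∧ Nonempty ((L ⧸ Module.annihilator L S) ≃+ (Fin b → S))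
      ∧
      (a ≤ b → ∃ q : Q, Submodule.span L {q} = ⊤) := by
  let := Module.IsTorsionBySet.module (R := L) (M := Q) (I := Module.annihilator L S)
    fun q p => hQ p p.2 q
  let := Module.IsTorsionBySet.module (R := L) (M := S) (I := Module.annihilator L S)
    fun q p => Module.mem_annihilator.1 p.2 q
  let T := L ⧸ Module.annihilator L S
  have hmk : Function.Surjective (Ideal.Quotient.mk (Module.annihilator L S)) :=
    Ideal.Quotient.mk_surjective
  have hST : IsSimpleModule T S := by
    have hnt := IsSimpleModule.nontrivial L S
    refine isSimpleModule_iff_toSpanSingleton_surjective.2 ⟨hnt, fun s hs s' => ?_⟩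
    obtain ⟨l, hl⟩ := (isSimpleModule_iff_toSpanSingleton_surjective (R := L).1 ‹_›).2 s hs s'
    exact ⟨Ideal.Quotient.mk (Module.annihilator L S) l, hl⟩
  have hf : FaithfulSMul T S := ⟨fun {t t'} h => by
    obtain ⟨l, rfl⟩ := hmk t
    obtain ⟨l', rfl⟩ := hmk t'
    refine (Submodule.Quotient.eq _).2 (Module.mem_annihilator.2 fun s => ?_)
    rw [sub_smul, sub_eq_zero]
    exact h s⟩
  obtain ⟨hT, hTf⟩ := IsSimpleRing.of_faithful_simple_finite T S
  obtain ⟨a, ⟨e⟩⟩ := IsSimpleRing.exists_linearEquiv_fun T S Q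
  obtain ⟨b, ⟨e'⟩⟩ := IsSimpleRing.exists_linearEquiv_fun T S T
  refine ⟨a, b, ⟨e.toAddEquiv⟩, ⟨e'.toAddEquiv⟩, fun hab => ?_⟩
  let f : T →ₗ[T] Q := e.symm.toLinearMap ∘ₗ LinearMap.funLeft T S (Fin.castLE hab) ∘ₗ
    e'.toLinearMap
  have hfs : Function.Surjective f :=
    e.symm.surjective.comp ((LinearMap.funLeft_surjective_of_injective T S _
      (Fin.castLE_injective hab)).comp e'.surjective)
  refine ⟨f 1, eq_top_iff.2 fun q _ => ?_⟩
  obtain ⟨t, rfl⟩ := hfs q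
  obtain ⟨l, rfl⟩ := hmk t
  refine Submodule.mem_span_singleton.2 ⟨l, ?_⟩
  change Ideal.Quotient.mk (Module.annihilator L S) l • f 1 = _
  rw [← map_smul, smul_eq_mul, mul_one]

theorem exists_span_singleton_eq_top_of_card_le
    (hQ : ∀ p ∈ Module.annihilator L S, ∀ q : Q, p • q = 0)
    (hcard : Nat.card Q ≤ Nat.card (L ⧸ Module.annihilator L S)) :
    ∃ q : Q, Submodule.span L {q} = ⊤ := by
  obtain ⟨a, b, ⟨e⟩, ⟨e'⟩, h⟩ := exists_linearEquiv_fun_of_annihilator S Q hQ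
  refine h ?_
  have := IsSimpleModule.nontrivial L S
  rw [Nat.card_congr e.toEquiv, Nat.card_congr e'.toEquiv, Nat.card_fun, Nat.card_fun,
    Nat.card_fin, Nat.card_fin] at hcard
  exact (Nat.pow_le_pow_iff_right Finite.one_lt_card).1 hcard

theorem card_le_card_of_annihilator [Nontrivial Q]
    (hQ : ∀ p ∈ Module.annihilator L S, ∀ q : Q, p • q = 0) : Nat.card S ≤ Nat.card Q := by
  obtain ⟨a, b, ⟨e⟩, -, -⟩ := exists_linearEquiv_fun_of_annihilator S Q hQ
  have := IsSimpleModule.nontrivial L S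
  have h1 : 1 < Nat.card Q := Finite.one_lt_card
  rw [Nat.card_congr e.toEquiv, Nat.card_fun, Nat.card_fin] at h1 ⊢
  refine Nat.le_self_pow ?_ _
  rintro rfl
  simp at h1

end simpleModule

/-! ### Elements acting on a simple module through a generator of a finite field. -/

/-- An element of a finite Galois extension whose conjugates are linearly independent is primitive
and has non-zero trace. -/
theorem exists_natDegree_minpoly_eq_and_coeff_ne_zero (κ E : Type*) [Field κ] [Field E]
    [Algebra κ E] [FiniteDimensional κ E] [IsGalois κ E] :
    ∃ θ : E, (minpoly κ θ).natDegree = Module.finrank κ E ∧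
      (minpoly κ θ).coeff (Module.finrank κ E - 1) ≠ 0 := by
  let θ := IsGalois.normalBasis κ E 1
  have hli : LinearIndependent κ fun σ : Gal(E/κ) => σ θ := by
    have := (IsGalois.normalBasis κ E).linearIndependent
    have h : (⇑(IsGalois.normalBasis κ E)) = fun σ : Gal(E/κ) => σ θ :=
      funext IsGalois.normalBasis_apply
    rwa [h] at this
  have hprim : IntermediateField.adjoin κ {θ} = ⊤ := by
    have h1 : (IntermediateField.adjoin κ {θ}).fixingSubgroup = ⊥ := by
      rw [eq_bot_iff]
      intro σ hσ
      have : σ θ = θ := hσ ⟨θ, IntermediateField.mem_adjoin_simple_self κ θ⟩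
      exact hli.injective (a₂ := 1) this
    rw [← IsGalois.fixedField_fixingSubgroup (IntermediateField.adjoin κ {θ}), h1,
      IntermediateField.fixedField_bot]
  have hint : IsIntegral κ θ := IsIntegral.of_finite κ θ
  have hdeg : (minpoly κ θ).natDegree = Module.finrank κ E := by
    rw [← IntermediateField.adjoin.finrank hint, hprim, IntermediateField.finrank_top']
  refine ⟨θ, hdeg, fun h0 => ?_⟩
  have htr : Algebra.trace κ E θ ≠ 0 := by
    intro h
    have h2 := trace_eq_sum_automorphisms (K := κ) θ
    rw [h, map_zero] at h2
    have := Fintype.linearIndependent_iff.1 hli (fun _ => 1) (by simpa using h2.symm) 1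
    exact one_ne_zero this
  refine htr ?_
  let pb := (IntermediateField.adjoin.powerBasis hint).map
    ((IntermediateField.equivOfEq hprim).trans IntermediateField.topEquiv)
  have hgen : pb.gen = θ := by
    simp [pb]
  have h3 := PowerBasis.trace_gen_eq_nextCoeff_minpoly pb
  rw [hgen, Polynomial.nextCoeff_of_natDegree_pos (by rw [hdeg]; exact Module.finrank_pos), hdeg,
    h0, neg_zero] at h3
  exact h3

open Polynomial in
/-- If `L` induces all `F`-linear endomorphisms of the finite `F`-space `S`, of cardinality `|κ| ^
s`
with `κ = O ⧸ 𝔪`, then some element of `L` has a minimal polynomial modulo `𝔪` of degree `s` and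
with non-zero trace coefficient. -/
theorem exists_le_natDegree_of_forall_exists_smul_eq {O L F S : Type*} [CommRing O] [Ring L]
    [Algebra O L] [AddCommGroup S] [Module L S] [Module O S] [IsScalarTower O L S] [Finite S]
    [Nontrivial S] [Field F] [Finite F] [Module F S] [Algebra O F] [IsScalarTower O F S]
    (hT : ∀ T : Module.End F S, ∃ a : L, ∀ x, a • x = T x) (𝔪 : Ideal O) [𝔪.IsMaximal]
    (h𝔪 : ∀ p ∈ 𝔪, ∀ x : S, p • x = 0) :
    ∃ (a : L) (s : ℕ), Nat.card S = Nat.card (O ⧸ 𝔪) ^ s ∧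
      ∀ P : O[X], P.Monic → (∀ x : S, aeval a P • x = 0) →
        s ≤ P.natDegree ∧ (P.natDegree = s → P.coeff (s - 1) ∉ 𝔪) := by
  obtain ⟨p, hp⟩ := CharP.exists F
  have : Fact p.Prime := ⟨CharP.char_is_prime F p⟩
  let : Algebra (ZMod p) F := ZMod.algebra F p
  have hpos : Module.finrank F S ≠ 0 := by
    exact Module.finrank_pos.ne'
  have : NeZero (Module.finrank F S) := ⟨hpos⟩
  -- `S` is identified with a field `E` of the same dimension over `F`; multiplication by a suitable
  -- `θ` is then an `F`-linear endomorphism of `S`.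
  let E := FiniteField.Extension F p (Module.finrank F S)
  let e : S ≃ₗ[F] E := LinearEquiv.ofFinrankEq S E
    (FiniteField.finrank_extension F p (Module.finrank F S)).symm
  let : Field (O ⧸ 𝔪) := Ideal.Quotient.field 𝔪
  let g : O →+* E := (algebraMap F E).comp (algebraMap O F)
  have hg : ∀ c ∈ 𝔪, g c = 0 := fun c hc => by
    have : algebraMap O F c = 0 := by
      obtain ⟨x, hx⟩ := exists_ne (0 : S)
      refine (smul_eq_zero_iff_left hx).1 ?_
      rw [algebraMap_smul, h𝔪 c hc x]
    simp [g, this]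
  let : Algebra O E := g.toAlgebra
  let : Algebra (O ⧸ 𝔪) E := (Ideal.Quotient.lift 𝔪 g hg).toAlgebra
  have : IsScalarTower O (O ⧸ 𝔪) E := .of_algebraMap_eq fun c => rfl
  have : FiniteDimensional (O ⧸ 𝔪) E := Module.Finite.of_finite
  obtain ⟨θ, hθ, hθ'⟩ := exists_natDegree_minpoly_eq_and_coeff_ne_zero (O ⧸ 𝔪) E
  let T : Module.End F S := e.symm.toLinearMap ∘ₗ LinearMap.mulLeft F θ ∘ₗ e.toLinearMap
  obtain ⟨a, ha⟩ := hT T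
  have haT (x : S) : e (a • x) = θ * e x := by
    simp [ha, T]
  have hc (c : O) (x : S) : e (c • x) = algebraMap O E c * e x := by
    rw [← algebraMap_smul F c x, map_smul, Algebra.smul_def]
    rfl
  have hpoly (P : O[X]) (x : S) : e (aeval a P • x) = aeval θ P * e x := by
    induction P using Polynomial.induction_on' generalizing x with
    | add p q hp hq => simp [add_smul, add_mul, hp, hq]
    | monomial n c =>
      simp only [aeval_monomial]
      rw [← Algebra.smul_def, smul_assoc, hc, mul_assoc]
      congr 1
      induction n generalizing x with
      | zero => simp
      | succ n ih => rw [pow_succ', mul_smul, haT, ih, pow_succ', mul_assoc]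
  refine ⟨a, Module.finrank (O ⧸ 𝔪) E, ?_, fun P hP h0 => ?_⟩
  · rw [Nat.card_congr e.toEquiv, Module.natCard_eq_pow_finrank (K := O ⧸ 𝔪)]
  have h1 : aeval θ P = 0 := by
    have := hpoly P (e.symm 1)
    rwa [h0, map_zero, LinearEquiv.apply_symm_apply, mul_one, eq_comm] at this
  have h2 : aeval θ (P.map (algebraMap O (O ⧸ 𝔪))) = 0 := by rwa [aeval_map_algebraMap]
  have hmon := hP.map (algebraMap O (O ⧸ 𝔪))
  have hdvd := minpoly.dvd (O ⧸ 𝔪) θ h2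
  have hdeg := natDegree_le_of_dvd hdvd hmon.ne_zero
  rw [hP.natDegree_map, hθ] at hdeg
  refine ⟨hdeg, fun heq hmem => hθ' ?_⟩
  -- In the extreme case of equal degrees, `P` modulo `𝔪` is the minimal polynomial of `θ`, so its
  -- trace coefficient is non-zero.
  have h3 := eq_of_monic_of_dvd_of_natDegree_le (minpoly.monic (IsIntegral.of_finite _ θ)) hmon hdvd
    (by rw [hP.natDegree_map, hθ, heq])
  rw [← h3, coeff_map]
  exact Ideal.Quotient.eq_zero_iff_mem.2 hmem

open Polynomial in
/-- The case of a finite simple module, where `F` is the endomorphism ring. -/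
theorem exists_le_natDegree_of_isSimpleModule {O L S : Type*} [CommRing O] [Ring L]
    [Algebra O L] [AddCommGroup S] [Module L S] [Module O S] [IsScalarTower O L S]
    [IsSimpleModule L S] [Finite S] (𝔪 : Ideal O) [𝔪.IsMaximal]
    (h𝔪 : ∀ p ∈ 𝔪, ∀ x : S, p • x = 0) :
    ∃ (a : L) (s : ℕ), Nat.card S = Nat.card (O ⧸ 𝔪) ^ s ∧
      ∀ P : O[X], P.Monic → (∀ x : S, aeval a P • x = 0) →
        s ≤ P.natDegree ∧ (P.natDegree = s → P.coeff (s - 1) ∉ 𝔪) := by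
  classical
  have : SMulCommClass L O S := IsScalarTower.to_smulCommClass'
  have hnt := IsSimpleModule.nontrivial L S
  have hFfin : Finite (Module.End L S) :=
    Finite.of_injective (fun f => (f : S → S)) DFunLike.coe_injective
  -- Density theorem: `L` induces all endomorphisms of `S` linear over its endomorphism ring, a
  -- finite division ring by Schur's lemma and a field by Wedderburn's theorem.
  have hT (T : Module.End (Module.End L S) S) : ∃ a : L, ∀ x, a • x = T x := by
    obtain ⟨a, ha⟩ := Module.Finite.toModuleEnd_moduleEnd_surjective (R := L) (M := S) T
    exact ⟨a, DFunLike.congr_fun ha⟩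
  have hOF : IsScalarTower O (Module.End L S) S := ⟨fun c f x => rfl⟩
  exact @exists_le_natDegree_of_forall_exists_smul_eq O L (Module.End L S) S _ _ _ _ _ _ _ _ _
    (littleWedderburn _) _ Module.End.applyModule (Module.End.instAlgebra O L S) hOF hT 𝔪 _ h𝔪

/-! ### A principal maximal left ideal containing the prime element. -/

/-- If a maximal left ideal `I` misses `c`, then `1 = b c + a` with `a ∈ I`; as `c` is central, `L =
I + c L`, and Nakayama's lemma over `O` gives `I = L`. -/
theorem algebraMap_mem_jacobson {O L : Type*} [CommRing O] [IsLocalRing O] [Ring L] [Algebra O L]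
    [Module.Finite O L] {c : O} (hc : c ∈ IsLocalRing.maximalIdeal O) :
    algebraMap O L c ∈ Ring.jacobson L := by
  rw [Ring.jacobson_eq_sInf_isMaximal, Submodule.mem_sInf]
  intro I hI
  by_contra hcI
  obtain ⟨b, a, ha, hab⟩ : ∃ b, ∃ a ∈ I, b * algebraMap O L c + a = 1 := by
    have h1 : Ideal.span {algebraMap O L c} ⊔ I = ⊤ := by
      refine hI.1.2 _ (lt_of_le_of_ne le_sup_right fun h => hcI ?_)
      rw [h]
      exact Ideal.mem_sup_left (Ideal.mem_span_singleton_self _)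
    obtain ⟨y, hy, a, ha, h⟩ := Submodule.mem_sup.1 (h1 ▸ Submodule.mem_top : (1 : L) ∈ _)
    obtain ⟨b, rfl⟩ := Submodule.mem_span_singleton.1 hy
    exact ⟨b, a, ha, h⟩
  have h2 : (⊤ : Submodule O L) ≤ I.restrictScalars O ⊔ Ideal.span {c} • (⊤ : Submodule O L) := by
    intro x _
    have hx : x = x * a + c • (x * b) := by
      rw [Algebra.smul_def, Algebra.commutes, mul_assoc, ← mul_add, add_comm, hab, mul_one]
    rw [hx]
    exact Submodule.add_mem_sup (Ideal.mul_mem_left (α := L) I x ha)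
      (Submodule.smul_mem_smul (Ideal.mem_span_singleton_self c) trivial)
  have h3 := Submodule.le_of_le_smul_of_le_jacobson_bot Module.Finite.fg_top
    ((Ideal.span_singleton_le_iff_mem _).2 ((IsLocalRing.maximalIdeal_le_jacobson ⊥) hc)) h2
  exact hI.ne_top (eq_top_iff.2 fun x _ => h3 (x := x) trivial)

theorem Submodule.eq_top_of_sup_jacobson_smul_eq_top {L M : Type*} [Ring L] [AddCommGroup M]
    [Module L M] [Module.Finite L M] {N : Submodule L M}
    (h : N ⊔ Ring.jacobson L • (⊤ : Submodule L M) = ⊤) : N = ⊤ := by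
  have h1 : (⊤ : Submodule L (M ⧸ N)) = ⊥ := by
    refine Module.Finite.fg_top.eq_bot_of_le_jacobson_smul ?_
    have := congrArg (Submodule.map N.mkQ) h
    rw [Submodule.map_sup, Submodule.map_smul'', Submodule.mkQ_map_self, bot_sup_eq,
      Submodule.map_top, Submodule.range_mkQ] at this
    exact this.ge
  rw [← N.ker_mkQ, ← Submodule.comap_bot, ← h1, Submodule.comap_top]

/-- Lifting of a generator along a semilocal ring `L`: if `M` becomes cyclic modulo the two-sided
ideal
`𝔓`, and `𝔓M` is contained in a cyclic submodule, then `M` is cyclic. -/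
theorem exists_span_singleton_eq_top_of_smul_le {L M : Type*} [Ring L] [AddCommGroup M] [Module L M]
    [Module.Finite L M] [IsArtinian L (L ⧸ Ring.jacobson L)] (𝔓 : Ideal L) [𝔓.IsTwoSided] (e m₀ : M)
    (h₁ : 𝔓 • (⊤ : Submodule L M) ≤ Submodule.span L {e})
    (h₂ : Submodule.span L {m₀} ⊔ 𝔓 • (⊤ : Submodule L M) = ⊤) :
    ∃ m : M, Submodule.span L {m} = ⊤ := by
  have hss : IsSemisimpleModule L (L ⧸ Ring.jacobson L) :=
    (IsArtinian.isSemisimpleModule_iff_jacobson L _).2 (Module.jacobson_quotient_jacobson L L)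
  -- `C` is the preimage of a complement of `𝔓` in the semisimple module `L / rad L`: it spans `L`
  -- together with `𝔓` and meets it inside the radical.
  obtain ⟨C', hC'⟩ := exists_isCompl (Submodule.map (Ring.jacobson L).mkQ 𝔓)
  let C : Ideal L := Submodule.comap (Ring.jacobson L).mkQ C'
  have hinf : 𝔓 ⊓ C ≤ Ring.jacobson L := fun x hx => by
    have := hC'.disjoint.le_bot
      (⟨Submodule.mem_map_of_mem hx.1, hx.2⟩ : (Ring.jacobson L).mkQ x ∈ _ ⊓ C')
    rwa [Submodule.mem_bot, Submodule.mkQ_apply, Submodule.Quotient.mk_eq_zero] at this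
  have hsup : 𝔓 ⊔ C = ⊤ := by
    refine eq_top_iff.2 fun x _ => ?_
    obtain ⟨y, hy, c, hc, hyc⟩ := Submodule.mem_sup.1
      (hC'.sup_eq_top ▸ Submodule.mem_top : (Ring.jacobson L).mkQ x ∈ _)
    obtain ⟨p, hp, rfl⟩ := hy
    refine Submodule.mem_sup.2 ⟨p, hp, x - p, ?_, by abel⟩
    change (Ring.jacobson L).mkQ (x - p) ∈ C'
    rwa [map_sub, ← hyc, add_sub_cancel_left]
  have hmem : (1 : L) ∈ 𝔓 ⊔ C := by
    rw [hsup]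
    trivial
  obtain ⟨a, ha, b, hb, hab⟩ := Submodule.mem_sup.1 hmem
  have hone (y : M) : a • y + b • y = y := by rw [← add_smul, hab, one_smul]
  have hP (y : M) : a • y ∈ 𝔓 • (⊤ : Submodule L M) := Submodule.smul_mem_smul ha trivial
  have hC (y : M) : b • y ∈ C • (⊤ : Submodule L M) := Submodule.smul_mem_smul hb trivial
  -- As in the Chinese remainder theorem, `m` agrees with `m₀` modulo `𝔓M` and with `e` modulo `CM`.
  obtain ⟨m, hmdef⟩ : ∃ m, m = b • m₀ + a • e := ⟨_, rfl⟩
  have hm : m ∈ Submodule.span L {m} := Submodule.mem_span_singleton_self m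
  have hMP : Submodule.span L {m} ⊔ 𝔓 • (⊤ : Submodule L M) = ⊤ := by
    refine eq_top_iff.2 (h₂.ge.trans (sup_le ((Submodule.span_singleton_le_iff_mem _ _).2 ?_)
        le_sup_right))
    have : m₀ = m + (a • m₀ - a • e) := by
      conv_lhs => rw [← hone m₀]
      rw [hmdef]
      abel
    rw [this]
    exact Submodule.add_mem_sup hm (Submodule.sub_mem _ (hP _) (hP _))
  have hMC : Submodule.span L {m} ⊔ C • (⊤ : Submodule L M) = ⊤ := by
    refine eq_top_iff.2 fun y _ => ?_
    rw [← hone y]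
    refine add_mem ?_ (Submodule.mem_sup_right (hC y))
    refine (h₁.trans ((Submodule.span_singleton_le_iff_mem _ _).2 ?_)) (hP y)
    have : e = m + (b • e - b • m₀) := by
      conv_lhs => rw [← hone e]
      rw [hmdef]
      abel
    rw [this]
    exact Submodule.add_mem_sup hm (Submodule.sub_mem _ (hC _) (hC _))
  refine ⟨m, Submodule.eq_top_of_sup_jacobson_smul_eq_top 
    (eq_top_iff.2 (hMP.ge.trans ?_))⟩
  -- Substituting `M = L m + C M` into `M = L m + 𝔓 M` leaves `M = L m + 𝔓 C M`, and Nakayama's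
  -- lemma applies.
  have h𝔓C : 𝔓 * C ≤ Ring.jacobson L := (Ideal.mul_le.2 fun p hp c hc =>
    Submodule.mem_inf.2 ⟨Ideal.mul_mem_right c 𝔓 hp, Ideal.mul_mem_left C p hc⟩).trans hinf
  refine sup_le le_sup_left ?_
  calc 𝔓 • (⊤ : Submodule L M)
      = 𝔓 • Submodule.span L {m} ⊔ (𝔓 * C) • (⊤ : Submodule L M) := by
        rw [Submodule.mul_smul, ← Submodule.smul_sup, hMC]
    _ ≤ _ := sup_le_sup Submodule.smul_le_right (Submodule.smul_mono_left h𝔓C)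

/-- Let `J` be a left ideal minimal above `P = L π`. If `J = L m` and `π = x m`, then `l ↦ l m`
induces an isomorphism of `L / L x` with the simple module `J / P`. That `J` is cyclic follows from
a count showing that `J / 𝔓 J` is no larger than `L / 𝔓`, where `𝔓` is the annihilator of `J / P`.
The hypothesis `hid` says that the right idealizer of a two-sided ideal containing `π` is `L`,
written without `π⁻¹`. -/
theorem exists_isSimpleModule_quotient_span_singleton {L : Type*} [Ring L] [Nontrivial L]
    [IsNoetherianRing L] {π : L} (hcomm : ∀ l, Commute π l) (hreg : ∀ l, l * π = 0 → l = 0)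
    (hinv : ∀ a b, a * b = π → b * a = π) (hjac : π ∈ Ring.jacobson L)
    (hfin : Finite (L ⧸ Ideal.span {π}))
    (hid : ∀ I : Ideal L, I.IsTwoSided → π ∈ I → ∀ z : L, (∀ p ∈ I, ∃ q ∈ I, p * z = q * π) →
      z ∈ Ideal.span {π}) :
    ∃ x : L, IsSimpleModule L (L ⧸ Ideal.span {x}) ∧ π ∈ Ideal.span {x} := by
  let P : Ideal L := Ideal.span {π}
  have hPjac : P ≤ Ring.jacobson L := (Ideal.span_singleton_le_iff_mem _).2 hjac
  have hPtop : P ≠ ⊤ := fun h => (Ring.jacobson_lt_top (R := L)).not_ge (h ▸ hPjac)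
  have : Finite (L ⧸ Ring.jacobson L) :=
    Finite.of_surjective _ (Submodule.factor_surjective hPjac)
  obtain ⟨J, hPJ⟩ : ∃ J : Ideal L, P ⋖ J := by
    have : Nontrivial (L ⧸ P) := Submodule.Quotient.nontrivial_iff.2 hPtop
    obtain ⟨a, ha⟩ := IsAtomic.exists_atom (Submodule L (L ⧸ P))
    have h1 := ((Submodule.comapMkQRelIso P).isAtom_iff a).2 ha
    exact ⟨_, Set.Ici.isAtom_iff.1 h1⟩
  let S := J ⧸ Submodule.comap J.subtype P
  have hS : IsSimpleModule L S := (covBy_iff_quot_is_simple hPJ.le).1 hPJ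
  let r : L →ₗ[L] L := LinearMap.toSpanSingleton L L π
  have hr : Function.Injective r := (injective_iff_map_eq_zero r).2 fun l hl => hreg l hl
  have hP : P = Submodule.map r ⊤ := by
    rw [Submodule.map_top, LinearMap.range_toSpanSingleton]
  let 𝔓 := Module.annihilator L S
  have h𝔓J (p : L) (hp : p ∈ 𝔓) (j : L) (hj : j ∈ J) : p * j ∈ P := by
    have := Module.mem_annihilator.1 hp (Submodule.Quotient.mk ⟨j, hj⟩)
    rw [← Submodule.Quotient.mk_smul, Submodule.Quotient.mk_eq_zero] at this
    exact this
  have hπP : π ∈ P := Ideal.mem_span_singleton_self π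
  have hπ𝔓 : π ∈ 𝔓 := by
    refine Module.mem_annihilator.2 fun s => ?_
    obtain ⟨j, rfl⟩ := Submodule.Quotient.mk_surjective _ s
    rw [← Submodule.Quotient.mk_smul, Submodule.Quotient.mk_eq_zero]
    change π * (j : L) ∈ P
    rw [hcomm]
    exact Ideal.mul_mem_left _ _ hπP
  -- The chain is `𝔓 π ≤ 𝔓 J ≤ L π ≤ J`.
  let N₁ : Ideal L := Submodule.map r 𝔓
  let N₂ : Ideal L := 𝔓 • J
  have hN₁₂ : N₁ ≤ N₂ := by
    rintro _ ⟨p, hp, rfl⟩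
    exact Submodule.smul_mem_smul hp (hPJ.le hπP)
  have hN₂P : N₂ ≤ P := Submodule.smul_le.2 h𝔓J
  -- Otherwise `J π⁻¹` would idealize `𝔓` from the right, hence lie in `L`, forcing `J ≤ L π`.
  have hne : ¬ N₂ ≤ N₁ := by
    intro h
    refine hPJ.lt.not_ge fun z hz => hid 𝔓 inferInstance hπ𝔓 z fun p hp => ?_
    obtain ⟨q, hq, hqz⟩ := h (Submodule.smul_mem_smul hp hz)
    exact ⟨q, hq, hqz.symm⟩
  have hrel (N N' : Ideal L) : N.toAddSubgroup.relIndex N'.toAddSubgroup =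
      Nat.card (N' ⧸ Submodule.comap N'.subtype N) := rfl
  have hSpos : Nat.card S ≠ 0 := by
    have h1 := AddSubgroup.relIndex_mul_index
      (show P.toAddSubgroup ≤ J.toAddSubgroup from hPJ.le)
    have h2 : P.toAddSubgroup.index = Nat.card (L ⧸ P) := rfl
    rw [hrel, h2] at h1
    exact left_ne_zero_of_mul (h1.trans_ne Nat.card_pos.ne')
  have hfS : Finite S := Nat.finite_of_card_ne_zero hSpos
  have hf𝔓 : Finite (L ⧸ 𝔓) := finite_quotient_annihilator S
  let Q := N₂ ⧸ Submodule.comap N₂.subtype N₁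
  let Q' := J ⧸ (𝔓 • ⊤ : Submodule L J)
  -- The index of `𝔓 π` in `J` is computed through `𝔓 J` and through `L π`; right multiplication by
  -- `π` identifies `L / 𝔓` with `L π / 𝔓 π`.
  have hcard : Nat.card Q * Nat.card Q' = Nat.card (L ⧸ 𝔓) * Nat.card S := by
    have h1 := AddSubgroup.relIndex_mul_relIndex N₁.toAddSubgroup N₂.toAddSubgroup J.toAddSubgroup
      hN₁₂ (hN₂P.trans hPJ.le)
    have h2 := AddSubgroup.relIndex_mul_relIndex N₁.toAddSubgroup P.toAddSubgroup J.toAddSubgroup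
      (hN₁₂.trans hN₂P) hPJ.le
    have h3 : N₁.toAddSubgroup.relIndex P.toAddSubgroup = Nat.card (L ⧸ 𝔓) := by
      rw [hP, show N₁.toAddSubgroup = 𝔓.toAddSubgroup.map r.toAddMonoidHom from rfl,
        show (Submodule.map r ⊤).toAddSubgroup = AddSubgroup.map r.toAddMonoidHom ⊤ from rfl,
        AddSubgroup.relIndex_map_map_of_injective _ _ hr, AddSubgroup.relIndex_top_right]
      rfl
    have h4 : Submodule.comap J.subtype N₂ = 𝔓 • ⊤ := by
      rw [← Submodule.comap_map_eq_of_injective J.injective_subtype (𝔓 • ⊤),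
        Submodule.map_smul'', Submodule.map_top, Submodule.range_subtype]
    rw [h3, ← h1, hrel, hrel, hrel, h4] at h2
    exact h2.symm
  have hpos := hcard.trans_ne (mul_ne_zero Nat.card_pos.ne' hSpos)
  have hQ : Finite Q := Nat.finite_of_card_ne_zero (left_ne_zero_of_mul hpos)
  have hQ' : Finite Q' := Nat.finite_of_card_ne_zero (right_ne_zero_of_mul hpos)
  have hQnt : Nontrivial Q := by
    refine Submodule.Quotient.nontrivial_iff.2 fun h => hne fun z hz => ?_
    have : (⟨z, hz⟩ : N₂) ∈ Submodule.comap N₂.subtype N₁ := h ▸ Submodule.mem_top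
    exact this
  -- `Q = 𝔓 J / 𝔓 π` is non-zero and killed by `𝔓`, so it is a non-trivial power of `S`.
  have hle : Nat.card S ≤ Nat.card Q := by
    refine card_le_card_of_annihilator (L := L) S Q fun p hp q => ?_
    obtain ⟨z, rfl⟩ := Submodule.Quotient.mk_surjective _ q
    rw [← Submodule.Quotient.mk_smul, Submodule.Quotient.mk_eq_zero]
    obtain ⟨l, hl⟩ := Submodule.mem_span_singleton.1 (hN₂P z.2)
    refine ⟨p * l, Ideal.mul_mem_right l 𝔓 hp, ?_⟩
    change p * l * π = p * (z : L)
    rw [mul_assoc, ← hl, smul_eq_mul]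
  obtain ⟨q, hq⟩ : ∃ q : Q', Submodule.span L {q} = ⊤ := by
    refine exists_span_singleton_eq_top_of_card_le (L := L) S Q' (fun p hp q => ?_) ?_
    · obtain ⟨z, rfl⟩ := Submodule.Quotient.mk_surjective _ q
      rw [← Submodule.Quotient.mk_smul, Submodule.Quotient.mk_eq_zero]
      exact Submodule.smul_mem_smul hp trivial
    · refine Nat.le_of_mul_le_mul_left ?_ (Nat.pos_of_ne_zero hSpos)
      rw [mul_comm _ (Nat.card (L ⧸ 𝔓)), ← hcard]
      exact Nat.mul_le_mul_right _ hle
  obtain ⟨m₀, rfl⟩ := Submodule.Quotient.mk_surjective _ q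
  obtain ⟨m, hm⟩ := exists_span_singleton_eq_top_of_smul_le 𝔓 (⟨π, hPJ.le hπP⟩ : J) m₀
    (Submodule.smul_le.2 fun p hp j _ => by
      obtain ⟨l, hl⟩ := Submodule.mem_span_singleton.1 (h𝔓J p hp j j.2)
      exact Submodule.mem_span_singleton.2 ⟨l, Subtype.ext hl⟩)
    (by
      have h := congrArg (Submodule.comap (𝔓 • ⊤ : Submodule L J).mkQ) hq
      rw [Submodule.comap_top, ← Submodule.mkQ_apply, ← Set.image_singleton, ← Submodule.map_span,
        Submodule.comap_map_mkQ, sup_comm] at h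
      exact h)
  have hspan (j : J) : ∃ l : L, l • m = j := by
    refine Submodule.mem_span_singleton.1 ?_
    rw [hm]
    trivial
  obtain ⟨x, hx⟩ := hspan ⟨π, hPJ.le hπP⟩
  have hxm : x * (m : L) = π := congrArg Subtype.val hx
  have hmx : (m : L) * x = π := hinv _ _ hxm
  let f : L →ₗ[L] S := Submodule.mkQ _ ∘ₗ LinearMap.toSpanSingleton L J m
  have hf : Function.Surjective f := (Submodule.mkQ_surjective _).comp hspan
  have hker : LinearMap.ker f = Ideal.span {x} := by
    ext l
    rw [LinearMap.mem_ker, Ideal.mem_span_singleton', LinearMap.comp_apply, Submodule.mkQ_apply,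
      Submodule.Quotient.mk_eq_zero]
    change l * (m : L) ∈ P ↔ _
    rw [Ideal.mem_span_singleton']
    refine exists_congr fun a => ⟨fun h => ?_, fun h => ?_⟩
    · refine (sub_eq_zero.1 (hreg _ ?_))
      rw [sub_mul, sub_eq_zero]
      nth_rw 2 [← hmx]
      rw [← mul_assoc, ← h, mul_assoc, mul_assoc, hcomm]
    · rw [← h, mul_assoc, hxm]
  refine ⟨x, ?_, Ideal.mem_span_singleton'.2 ⟨m, hmx⟩⟩
  rw [← hker]
  exact IsSimpleModule.congr (f.quotKerEquivOfSurjective hf)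

/-! ### Determinants and indices. -/

/-- If `π` is a prime of the principal ideal domain `O`, generating a maximal ideal with residue
field
of cardinality `q`, and `f` is an endomorphism of a free module with cokernel killed by `π` and
determinant divisible by `π ^ n`, then the cokernel has at least `q ^ n` elements. -/
theorem card_pow_le_card_quotient_range {O V : Type*} [CommRing O] [IsDomain O]
    [IsPrincipalIdealRing O] [AddCommGroup V] [Module O V] [Module.Free O V] [Module.Finite O V]
    {π : O} (hπ : Irreducible π) [Finite (O ⧸ Ideal.span {π})] (f : V →ₗ[O] V)
    (hf : ∀ v, π • v ∈ LinearMap.range f) {n : ℕ} (hn : π ^ n ∣ LinearMap.det f) :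
    Nat.card (O ⧸ Ideal.span {π}) ^ n ≤ Nat.card (V ⧸ LinearMap.range f) := by
  classical
  let N := LinearMap.range f
  let ι := Module.Free.ChooseBasisIndex O V
  let b : Module.Basis ι O V := Module.Free.chooseBasis O V
  have hrank : Module.finrank O N = Module.finrank O V := by
    refine le_antisymm N.finrank_le ?_
    refine LinearMap.finrank_le_finrank_of_injective
      (f := (LinearMap.lsmul O V π).codRestrict N hf) fun v w h => ?_
    exact smul_right_injective V hπ.ne_zero (congrArg Subtype.val h)
  let a := Submodule.smithNormalFormCoeffs b hrank
  let b' := Submodule.smithNormalFormTopBasis b hrank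
  let c := Submodule.smithNormalFormBotBasis b hrank
  have hc : ∀ i, (c i : V) = a i • b' i := Submodule.smithNormalFormBotBasis_def b hrank
  -- The cokernel is killed by `π`, so each elementary divisor is a unit or associated to `π`.
  have ha (i : ι) : a i ∣ π := by
    have h1 := congrArg (b'.coord i ∘ Subtype.val) (c.sum_repr ⟨π • b' i, hf _⟩)
    simp only [Function.comp_apply, Submodule.coe_sum, Submodule.coe_smul, hc, map_sum, map_smul,
      Module.Basis.coord_apply, Module.Basis.repr_self, smul_eq_mul, Finsupp.single_apply,
      mul_ite, mul_one, mul_zero, Finset.sum_ite_eq', Finset.mem_univ, if_true] at h1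
    exact ⟨_, by rw [mul_comm]; exact h1.symm⟩
  have hd (i : ι) : ∃ d : ℕ, Associated (a i) (π ^ d) ∧
      Nat.card (O ⧸ Ideal.span {a i}) = Nat.card (O ⧸ Ideal.span {π}) ^ d := by
    obtain h | h := hπ.dvd_iff.1 (ha i)
    · refine ⟨0, by simpa using associated_one_iff_isUnit.2 h, ?_⟩
      rw [Ideal.span_singleton_eq_top.2 h, pow_zero]
      exact Nat.card_unique
    · refine ⟨1, by simpa using h.symm, ?_⟩
      rw [pow_one, Ideal.span_singleton_eq_span_singleton.2 h.symm]
  choose d hd hd' using hd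
  -- `f` is the diagonal map of elementary divisors composed with a surjective endomorphism, which
  -- is automatically bijective.
  have hdet : Associated (LinearMap.det f) (∏ i, a i) := by
    let g : V ≃ₗ[O] N := b'.equiv c (Equiv.refl _)
    have hg : N.subtype ∘ₗ g.toLinearMap = Matrix.toLin b' b' (Matrix.diagonal a) := by
      refine b'.ext fun i => ?_
      simp [g, hc, Matrix.toLin_self, Matrix.diagonal_apply]
    let f' : V →ₗ[O] V := g.symm.toLinearMap ∘ₗ f.rangeRestrict
    have hf' : Function.Surjective f' := g.symm.surjective.comp f.surjective_rangeRestrict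
    have hf'' : Function.Bijective f' := ⟨OrzechProperty.injective_of_surjective_endomorphism f'
        hf', hf'⟩
    have h1 : f = Matrix.toLin b' b' (Matrix.diagonal a) ∘ₗ f' := by
      rw [← hg]
      ext v
      simp [f']
    rw [h1, LinearMap.det_comp, LinearMap.det_toLin, Matrix.det_diagonal]
    exact associated_mul_unit_left _ _
      (LinearEquiv.isUnit_det' (LinearEquiv.ofBijective f' hf''))
  have hprod : Associated (∏ i, a i) (π ^ ∑ i, d i) := by
    rw [← Finset.prod_pow_eq_pow_sum]
    exact Associated.prod _ _ _ fun i _ => hd i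
  have hle : n ≤ ∑ i, d i := by
    rw [← pow_dvd_pow_iff hπ.ne_zero hπ.not_isUnit]
    exact hn.trans (hdet.trans hprod).dvd
  rw [Nat.card_congr (N.quotientEquivPiSpan b hrank).toEquiv, Nat.card_pi]
  change _ ≤ ∏ i, Nat.card (O ⧸ Ideal.span {a i})
  rw [Finset.prod_congr rfl fun i _ => hd' i, Finset.prod_pow_eq_pow_sum]
  exact Nat.pow_le_pow_right Nat.card_pos hle

/-- The finite dual basis defined by a basis. -/
noncomputable def Module.Basis.finiteDualBasis {R M : Type*} [CommRing R] [AddCommGroup M] [Module R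
    M]
    {N : ℕ} (b : Module.Basis (Fin N) R M) : FiniteDualBasis R M N where
  e := b
  f := b.coord
  sum_smul := b.sum_repr

theorem Module.Basis.det_mulRight_eq_det_mulRightMatrix {R M : Type*} [CommRing R] [Ring M]
    [Algebra R M] {N : ℕ} (b : Module.Basis (Fin N) R M) (x : M) :
    LinearMap.det (LinearMap.mulRight R x) =
      (b.finiteDualBasis.mulRightMatrix (b.finiteDualBasis.coord ((1 : R) ⊗ₜ[R] x))).det := by
  rw [← LinearMap.det_toMatrix b]
  congr 1
  ext i j
  rw [LinearMap.toMatrix_apply, LinearMap.mulRight_apply]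
  conv_lhs => rw [← b.sum_repr x, Finset.mul_sum, map_sum, Finset.sum_apply']
  simp only [FiniteDualBasis.mulRightMatrix, Matrix.of_apply, FiniteDualBasis.coord_tmul,
    finiteDualBasis, coord_apply, repr_self, Finsupp.single_apply, Algebra.algebraMap_self,
    RingHom.id_apply, eq_comm (a := i)]
  simp [mul_comm]

/-! ### Orders over a discrete valuation ring. -/

section

variable {O : Type u} {k : Type v} {A : Type w} [CommRing O] [IsDomain O] [IsDiscreteValuationRing
    O]
  [Field k] [CharZero k] [Algebra O k] [IsFractionRing O k] [Ring A] [Algebra k A]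
  [FiniteDimensional k A] [Algebra.IsCentral k A] [IsSimpleRing A] [Algebra O A]
  [IsScalarTower O k A] {Λ : Subalgebra O A}

open Polynomial in
/-- The reduced characteristic polynomial of an element of an order. -/
theorem exists_monic_polynomial_aeval_eq_zero (hΛ : IsOrderIn O k A Λ) {n : ℕ} (hn : n ≠ 0)
    (φ : AlgebraicClosure k ⊗[k] A ≃ₐ[AlgebraicClosure k]
      Matrix (Fin n) (Fin n) (AlgebraicClosure k)) (a : Λ) :
    ∃ P : O[X], P.Monic ∧ P.natDegree = n ∧ aeval a P = 0 ∧
      algebraMap O k (P.coeff (n - 1)) = -reducedTrace k A a := by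
  let ℓ := AlgebraicClosure k
  have hf : Module.Finite O Λ := Module.Finite.iff_fg.2 hΛ.fg
  have hOA : Module.IsTorsionFree O A := .trans_faithfulSMul O k A
  have hfree : Module.Free O Λ := Module.free_of_finite_type_torsion_free'
  have hinj : Function.Injective (algebraMap O ℓ) :=
    have := faithfulSMul_algebraicClosure (R := O) (k := k)
    FaithfulSMul.algebraMap_injective O ℓ
  let ν := reducedNorm O k A Λ
  have hν : IsReducedNorm O k A Λ ν := isReducedNorm_reducedNorm hΛ.span_eq_top
  -- The reduced norm of `X - a`.
  let P : O[X] := evalAt (X ⊗ₜ[O] 1 + (-1) ⊗ₜ[O] a) ν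
  have hP : P.map (algebraMap O ℓ) = (φ (1 ⊗ₜ (a : A))).charpoly := by
    rw [hν.map_evalAt_pencil φ a]
    congr 1
    ext1 i j
    by_cases hij : i = j <;> simp [Matrix.charmatrix, Matrix.scalar_apply, hij, sub_eq_add_neg]
  have hne : NeZero n := ⟨hn⟩
  refine ⟨P, ?_, ?_, ?_, ?_⟩
  · refine hinj.monic_map_iff.2 ?_
    rw [hP]
    exact Matrix.charpoly_monic _
  · rw [← natDegree_map_eq_of_injective hinj, hP, Matrix.charpoly_natDegree_eq_dim,
      Fintype.card_fin]
  · let g₀ : A →ₐ[k] Matrix (Fin n) (Fin n) ℓ :=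
      (φ.toAlgHom.restrictScalars k).comp Algebra.TensorProduct.includeRight
    let g : Λ →ₐ[O] Matrix (Fin n) (Fin n) ℓ := (g₀.restrictScalars O).comp Λ.val
    have hg : Function.Injective g :=
      (RingHom.injective g₀.toRingHom).comp Subtype.val_injective
    refine hg ?_
    rw [map_zero, ← aeval_algHom_apply, ← aeval_map_algebraMap ℓ, hP]
    exact Matrix.aeval_self_charpoly _
  · refine (algebraMap k ℓ).injective ?_
    rw [← IsScalarTower.algebraMap_apply, ← coeff_map, hP, map_neg,
      isReducedTrace_reducedTrace k A ℓ n φ, Matrix.trace_eq_neg_charpoly_coeff, neg_neg,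
      Fintype.card_fin]

/-- A non-unit `x` of an order, with `x` dividing the prime element, generates a left ideal of index
at least `q ^ n`. -/
theorem card_pow_le_card_quotient_span_singleton (hΛ : IsOrderIn O k A Λ) {n : ℕ}
    (φ : AlgebraicClosure k ⊗[k] A ≃ₐ[AlgebraicClosure k]
      Matrix (Fin n) (Fin n) (AlgebraicClosure k)) {π : O} (hπ : Irreducible π)
    [Finite (O ⧸ Ideal.span {π})] {x : Λ} (hx : ¬ IsUnit x)
    (hπx : algebraMap O Λ π ∈ Ideal.span {x}) :
    Nat.card (O ⧸ Ideal.span {π}) ^ n ≤ Nat.card (Λ ⧸ Ideal.span {x}) := by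
  have hf : Module.Finite O Λ := Module.Finite.iff_fg.2 hΛ.fg
  have hOA : Module.IsTorsionFree O A := .trans_faithfulSMul O k A
  have hfree : Module.Free O Λ := Module.free_of_finite_type_torsion_free'
  let ν := reducedNorm O k A Λ
  have hν : IsReducedNorm O k A Λ ν := isReducedNorm_reducedNorm hΛ.span_eq_top
  have hu : ¬ IsUnit (evalAt ((1 : O) ⊗ₜ[O] x) ν) := fun h => hx <| by
    have := (hν.isUnit_of_isUnit_evalAt hΛ.span_eq_top h).map (Algebra.TensorProduct.lid O Λ)
    rwa [Algebra.TensorProduct.lid_tmul, one_smul] at this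
  have hdvd : π ∣ evalAt ((1 : O) ⊗ₜ[O] x) ν := by
    rw [← Ideal.mem_span_singleton, ← hπ.maximalIdeal_eq]
    exact (IsLocalRing.mem_maximalIdeal _).2 hu
  let b := Module.finBasis O Λ
  -- The determinant is `nrd x ^ n`, and `π` divides `nrd x` because `x` is not a unit.
  have hdet : π ^ n ∣ LinearMap.det (LinearMap.mulRight O x) := by
    rw [b.det_mulRight_eq_det_mulRightMatrix,
      hν.det_mulRightMatrix b.finiteDualBasis hΛ.span_eq_top φ]
    exact pow_dvd_pow_of_dvd hdvd n
  obtain ⟨y, hy⟩ := Ideal.mem_span_singleton'.1 hπx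
  refine (card_pow_le_card_quotient_range hπ (LinearMap.mulRight O x)
    (fun v => ⟨v * y, ?_⟩) hdet).trans_eq ?_
  · rw [LinearMap.mulRight_apply, mul_assoc, hy, Algebra.smul_def, Algebra.commutes]
  · have h : LinearMap.range (LinearMap.mulRight O x) =
        (Ideal.span {x} : Ideal Λ).restrictScalars O := by
      ext z
      simp [Ideal.mem_span_singleton', eq_comm]
    rw [h]
    rfl

/-- The reduced trace of an order over a discrete valuation ring with finite residue field is
surjective, provided that the order contains the right idealizers of its two-sided ideals of full
rank. -/
theorem exists_reducedTrace_ne_algebraMap (hΛ : IsOrderIn O k A Λ)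
    (hfin : Finite (O ⧸ IsLocalRing.maximalIdeal O))
    (hid : ∀ I : Ideal Λ, I.IsTwoSided → (∃ c : O, c ≠ 0 ∧ algebraMap O Λ c ∈ I) → ∀ y : A,
      (∀ p ∈ I, ∃ q ∈ I, (p : A) * y = (q : A)) → y ∈ Λ) :
    ∃ a ∈ Λ, ∀ c ∈ IsLocalRing.maximalIdeal O, reducedTrace k A a ≠ algebraMap O k c := by
  have hf : Module.Finite O Λ := Module.Finite.iff_fg.2 hΛ.fg
  have hOA : Module.IsTorsionFree O A := .trans_faithfulSMul O k A
  have hfree : Module.Free O Λ := Module.free_of_finite_type_torsion_free'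
  obtain ⟨π, hπ⟩ := IsDiscreteValuationRing.exists_irreducible O
  have hmax := hπ.maximalIdeal_eq
  have hfin' : Finite (O ⧸ Ideal.span {π}) := hmax ▸ hfin
  have hπk : algebraMap O k π ≠ 0 := by
    simpa using hπ.ne_zero
  -- The inverse of the prime element inside `A`.
  let ϖ : A := algebraMap k A (algebraMap O k π)⁻¹
  have hϖ (y : A) : Commute ϖ y := Algebra.commute_algebraMap_left _ y
  have hϖπ : ϖ * algebraMap O A π = 1 := by
    rw [IsScalarTower.algebraMap_apply O k A, ← map_mul, inv_mul_cancel₀ hπk, map_one]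
  have hπϖ : algebraMap O A π * ϖ = 1 := by rw [← hϖ, hϖπ]
  have hart : IsArtinianRing A := IsArtinianRing.of_finite k A
  let p : Λ := algebraMap O Λ π
  have hp : (p : A) = algebraMap O A π := rfl
  have hpc (l : Λ) : Commute p l := Algebra.commute_algebraMap_left _ l
  have hnt : Nontrivial Λ := inferInstance
  have hnoeth : IsNoetherianRing Λ := isNoetherian_of_tower O inferInstance
  have hfinΛ : Finite (Λ ⧸ Ideal.span {p}) := by
    have : Finite (Λ ⧸ Ideal.span {π} • (⊤ : Submodule O Λ)) :=
      Submodule.finite_quotient_smul _ Module.Finite.fg_top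
    have hle : Ideal.span {π} • (⊤ : Submodule O Λ) ≤ (Ideal.span {p} : Ideal Λ).restrictScalars O
        := by
      refine Submodule.smul_le.2 fun c hc l _ => ?_
      obtain ⟨d, rfl⟩ := Ideal.mem_span_singleton'.1 hc
      refine Ideal.mem_span_singleton'.2 ⟨d • l, ?_⟩
      rw [← (hpc _).eq, mul_smul_comm, mul_smul, Algebra.smul_def π]
    exact Finite.of_surjective _ (Submodule.factor_surjective hle)
  obtain ⟨x, hS, hpx⟩ := exists_isSimpleModule_quotient_span_singleton (π := p) hpc
    (fun l hl => by
      refine Subtype.ext ?_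
      have := congrArg (fun z : Λ => (z : A) * ϖ) hl
      simpa [hp, mul_assoc, (hϖ _).eq.symm.trans hϖπ] using this)
    (fun a b hab => by
      have h1 : (ϖ * a) * b = 1 := by
        rw [mul_assoc, ← hϖπ, ← hp, ← hab]
        rfl
      -- In the Artinian ring `A` a one-sided inverse is two-sided, so `a b = π` implies `b a = π`.
      have h2 := congrArg (algebraMap O A π * ·) (mul_eq_one_comm.1 h1)
      refine Subtype.ext ?_
      simpa [hp, ← mul_assoc, ← (hϖ (b : A)).eq, hπϖ] using h2)
    (algebraMap_mem_jacobson (hmax ▸ Ideal.mem_span_singleton_self π)) hfinΛ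
    (fun I hI hpI z hz => by
      have h1 : ϖ * z ∈ Λ := by
        refine hid I hI ⟨π, hπ.ne_zero, hpI⟩ _ fun r hr => ?_
        obtain ⟨q, hq, hqz⟩ := hz r hr
        refine ⟨q, hq, ?_⟩
        have := congrArg (fun z : Λ => ϖ * (z : A)) hqz
        simpa [hp, ← mul_assoc, (hϖ _).eq, mul_assoc (q : A), hπϖ] using this
      refine Ideal.mem_span_singleton'.2 ⟨⟨_, h1⟩, Subtype.ext ?_⟩
      simp [hp, mul_assoc, ← Algebra.commutes π (z : A), ← mul_assoc ϖ, hϖπ])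
  obtain ⟨n, hn, ⟨φ⟩⟩ := exists_splitting_algebraicClosure k A
  have hx : ¬ IsUnit x := fun h => by
    have := IsSimpleModule.nontrivial Λ (Λ ⧸ Ideal.span {x})
    refine Submodule.Quotient.nontrivial_iff.1 this ?_
    exact Ideal.eq_top_of_isUnit_mem _ (Ideal.mem_span_singleton_self x) h
  have hcard := card_pow_le_card_quotient_span_singleton hΛ φ hπ hx hpx
  have hSfin : Finite (Λ ⧸ Ideal.span {x}) := Finite.of_surjective _
    (Submodule.factor_surjective ((Ideal.span_singleton_le_iff_mem _).2 hpx))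
  have hmax' : (Ideal.span {π}).IsMaximal := hmax ▸ inferInstance
  obtain ⟨a, s, hs, hPa⟩ := exists_le_natDegree_of_isSimpleModule (L := Λ)
    (S := Λ ⧸ Ideal.span {x}) (Ideal.span {π}) fun c hc y => by
      obtain ⟨l, rfl⟩ := Submodule.Quotient.mk_surjective _ y
      obtain ⟨d, rfl⟩ := Ideal.mem_span_singleton'.1 hc
      rw [← Submodule.Quotient.mk_smul, Submodule.Quotient.mk_eq_zero, Algebra.smul_def, map_mul,
        mul_assoc, Algebra.commutes π, ← mul_assoc]
      exact Ideal.mul_mem_left _ _ hpx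
  obtain ⟨P, hmon, hdeg, hPa0, htr⟩ := exists_monic_polynomial_aeval_eq_zero hΛ hn φ a
  obtain ⟨h1, h2⟩ := hPa P hmon fun y => by rw [hPa0, zero_smul]
  have hκ : Nontrivial (O ⧸ Ideal.span {π}) := Ideal.Quotient.nontrivial_iff.2 hmax'.ne_top
  -- The index bound gives `n ≤ s`, and the polynomial of degree `n` killing `S` gives `s ≤ n`.
  rw [hs, Nat.pow_le_pow_iff_right Finite.one_lt_card] at hcard
  rw [hdeg] at h1 h2
  have hns := le_antisymm hcard h1
  refine ⟨a, a.2, fun c hc hac => h2 hns ?_⟩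
  rw [hac, ← map_neg] at htr
  rw [← hns, IsFractionRing.injective O k htr, ← hmax]
  exact neg_mem hc

end

/-! ### Localization of maximal orders. -/

section localization

variable {R : Type u} {k : Type v} {A : Type w} [CommRing R] [Field k] [Algebra R k]
  [Ring A] [Algebra k A] [Algebra R A] [IsScalarTower R k A] (𝔭 : Ideal R) [𝔭.IsPrime]
  (O : Type u) [CommRing O] [Algebra R O] [IsLocalization.AtPrime O 𝔭] [Algebra O A]
  [IsScalarTower R O A] (Λ : Subalgebra R A)

/-- The localization at a prime ideal of a subalgebra of `A`. -/
def Subalgebra.atPrime : Subalgebra O A where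
  carrier := {a | ∃ s ∉ 𝔭, s • a ∈ Λ}
  mul_mem' := by
    rintro a b ⟨s, hs, ha⟩ ⟨t, ht, hb⟩
    refine ⟨s * t, 𝔭.primeCompl.mul_mem hs ht, ?_⟩
    rw [← smul_mul_smul_comm]
    exact mul_mem ha hb
  add_mem' := by
    rintro a b ⟨s, hs, ha⟩ ⟨t, ht, hb⟩
    refine ⟨s * t, 𝔭.primeCompl.mul_mem hs ht, ?_⟩
    rw [smul_add, mul_comm, mul_smul, mul_comm, mul_smul]
    exact add_mem (Λ.smul_mem ha t) (Λ.smul_mem hb s)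
  algebraMap_mem' c := by
    obtain ⟨⟨r, s⟩, h⟩ := IsLocalization.surj 𝔭.primeCompl c
    refine ⟨s, s.2, ?_⟩
    rw [Algebra.smul_def, IsScalarTower.algebraMap_apply R O A, ← map_mul, mul_comm, h,
      ← IsScalarTower.algebraMap_apply]
    exact Λ.algebraMap_mem r

variable {𝔭 O Λ}

theorem Subalgebra.mem_atPrime_of_mem {a : A} (ha : a ∈ Λ) : a ∈ Λ.atPrime 𝔭 O :=
  ⟨1, 𝔭.primeCompl.one_mem, by rwa [one_smul]⟩

omit [Algebra R k] [IsScalarTower R k A] in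
theorem IsOrderIn.atPrime (hΛ : IsOrderIn R k A Λ) [Algebra O k] [IsScalarTower O k A] :
    IsOrderIn O k A (Λ.atPrime 𝔭 O) where
  fg := by
    obtain ⟨T, hT⟩ := hΛ.fg
    refine ⟨T, le_antisymm (Submodule.span_le.2 fun t ht =>
      Subalgebra.mem_atPrime_of_mem (O := O) (𝔭 := 𝔭) (Λ := Λ) ?_) ?_⟩
    · rw [← Subalgebra.mem_toSubmodule, ← hT]
      exact Submodule.subset_span ht
    · rintro a ⟨s, hs, ha⟩
      rw [← Subalgebra.mem_toSubmodule, ← hT] at ha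
      have h1 : s • a ∈ Submodule.span O (T : Set A) := Submodule.span_le_restrictScalars R O _ ha
      obtain ⟨u, hu⟩ := IsLocalization.map_units O (⟨s, hs⟩ : 𝔭.primeCompl)
      have h2 : a = (↑u⁻¹ : O) • s • a := by
        rw [← algebraMap_smul O s a, ← hu, smul_smul, Units.inv_mul, one_smul]
      rw [h2]
      exact Submodule.smul_mem _ _ h1
  span_eq_top := top_le_iff.1 (hΛ.span_eq_top.ge.trans
    (Submodule.span_mono fun _ => Subalgebra.mem_atPrime_of_mem))

omit [Algebra R k] [IsScalarTower R k A] in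
-- The right idealizer `Γ` of `N = Λ ∩ I` is an order containing `Λ`, hence equal to it by
-- maximality. Since `N` is finitely generated, a common denominator outside `𝔭` moves `y` into `Γ`.
theorem mem_atPrime_of_forall_mul_mem [IsNoetherianRing R] [IsDomain R]
    [Module.IsTorsionFree R A]
    (hΛ : Maximal (IsOrderIn R k A) Λ) (I : Ideal (Λ.atPrime 𝔭 O)) [I.IsTwoSided]
    {c : O} (hc : c ≠ 0) (hcI : algebraMap O (Λ.atPrime 𝔭 O) c ∈ I) {y : A}
    (hy : ∀ p ∈ I, ∃ q ∈ I, (p : A) * y = (q : A)) : y ∈ Λ.atPrime 𝔭 O := by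
  let N : Submodule R A := Subalgebra.toSubmodule Λ ⊓
    ((I.restrictScalars R).map ((Λ.atPrime 𝔭 O).val.toLinearMap.restrictScalars R))
  have hN {a : A} : a ∈ N ↔ a ∈ Λ ∧ ∃ q ∈ I, (q : A) = a := Iff.rfl
  have hΛN {a : A} (ha : a ∈ N) {l : A} (hl : l ∈ Λ) : a * l ∈ N := by
    obtain ⟨h1, q, hq, rfl⟩ := hN.1 ha
    exact hN.2 ⟨mul_mem h1 hl, q * ⟨l, Subalgebra.mem_atPrime_of_mem hl⟩,
      Ideal.mul_mem_right _ _ hq, rfl⟩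
  let Γ : Subalgebra R A :=
    { carrier := {g | ∀ a ∈ N, a * g ∈ N}
      mul_mem' := fun {g g'} hg hg' a ha => by
        rw [← mul_assoc]
        exact hg' _ (hg _ ha)
      add_mem' := fun {g g'} hg hg' a ha => by
        rw [mul_add]
        exact add_mem (hg _ ha) (hg' _ ha)
      algebraMap_mem' := fun r a ha => hΛN ha (Λ.algebraMap_mem r) }
  have hfΛ : Module.Finite R Λ := Module.Finite.iff_fg.2 hΛ.prop.fg
  obtain ⟨r, hr, hrN⟩ : ∃ r : R, r ≠ 0 ∧ algebraMap R A r ∈ N := by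
    obtain ⟨⟨r, s⟩, h⟩ := IsLocalization.surj 𝔭.primeCompl c
    refine ⟨r, ?_, hN.2 ⟨Λ.algebraMap_mem r, algebraMap R O s • algebraMap O _ c, ?_, ?_⟩⟩
    · rintro rfl
      rw [map_zero] at h
      exact hc ((IsLocalization.map_units O s).mul_left_eq_zero.1 h)
    · exact Submodule.smul_of_tower_mem I _ hcI
    · rw [IsScalarTower.algebraMap_apply R O A, ← h, mul_comm, map_mul, Algebra.smul_def]
      rfl
  have hΓ : IsOrderIn R k A Γ := by
    refine ⟨Module.Finite.iff_fg.1 ?_, top_le_iff.1 (hΛ.prop.span_eq_top.ge.trans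
      (Submodule.span_mono fun l hl a ha => hΛN ha hl))⟩
    -- `N` contains the non-zero scalar `r`, so multiplication by `r` embeds `Γ` into the noetherian
    -- module `Λ`.
    let f : Γ →ₗ[R] Λ := LinearMap.codRestrict (Subalgebra.toSubmodule Λ)
      ((LinearMap.lsmul R A r) ∘ₗ (Subalgebra.toSubmodule Γ).subtype) fun g => by
        have := (hN.1 (g.2 _ hrN)).1
        rwa [← Algebra.smul_def] at this
    refine Module.Finite.of_injective f fun g g' h => Subtype.ext ?_
    exact smul_right_injective A hr (congrArg Subtype.val h)
  have hle : Γ ≤ Λ := hΛ.2 hΓ fun l hl a ha => hΛN ha hl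
  have hNfg : N.FG := by
    have : IsNoetherian R (Subalgebra.toSubmodule Λ) := isNoetherian_of_isNoetherianRing_of_finite R
        Λ
    exact isNoetherian_submodule.1 this _ inf_le_left
  classical
  obtain ⟨T, hT⟩ := hNfg
  have hden : ∀ t ∈ T, ∃ s ∉ 𝔭, s • (t * y) ∈ N := by
    intro t ht
    obtain ⟨h1, p, hp, rfl⟩ := hN.1 (hT ▸ Submodule.subset_span ht : t ∈ N)
    obtain ⟨q, hq, hpq⟩ := hy p hp
    obtain ⟨s, hs, hsq⟩ := q.2
    refine ⟨s, hs, ?_⟩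
    rw [hpq]
    exact hN.2 ⟨hsq, s • q, Submodule.smul_of_tower_mem I s hq, rfl⟩
  choose! s hs hsN using hden
  refine ⟨∏ t ∈ T, s t, prod_mem (S := 𝔭.primeCompl) hs, hle fun a ha => ?_⟩
  rw [← hT] at ha
  induction ha using Submodule.span_induction with
  | mem t ht =>
    rw [mul_smul_comm, ← Finset.prod_erase_mul T s ht, mul_smul]
    exact N.smul_mem _ (hsN t ht)
  | zero => simp
  | add a b _ _ ha hb => 
    rw [add_mul]
    exact add_mem ha hb
  | smul r a _ ha =>
    rw [smul_mul_assoc]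
    exact N.smul_mem _ ha

end localization

/-! ### From the localizations to the Dedekind domain. -/

section

variable {R : Type u} {k : Type v} {A : Type w}
    [CommRing R] [IsDedekindDomain R] [Field k] [CharZero k] [Algebra R k] [IsFractionRing R k]
    [Ring A] [Algebra k A] [FiniteDimensional k A] [Algebra.IsCentral k A] [IsSimpleRing A]
    [Algebra R A] [IsScalarTower R k A] {Λ : Subalgebra R A}

omit [CharZero k] [FiniteDimensional k A] [Algebra.IsCentral k A] in
-- A torsion-free module over a Dedekind domain is flat, and flat modules of finite presentation are
-- projective.
theorem IsOrderIn.finite_projective (hΛ : IsOrderIn R k A Λ) :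
    Module.Finite R Λ ∧ Module.Projective R Λ := by
  have hf : Module.Finite R Λ := Module.Finite.iff_fg.2 hΛ.fg
  have hRA : Module.IsTorsionFree R A := .trans_faithfulSMul R k A
  have := Module.finitePresentation_of_finite R Λ
  exact ⟨hf, Module.Flat.projective_of_finitePresentation⟩

theorem IsOrderIn.exists_algebraMap_eq_reducedTrace (hΛ : IsOrderIn R k A Λ) {a : A} (ha : a ∈ Λ) :
    ∃ r, algebraMap R k r = reducedTrace k A a := by
  obtain ⟨hf, hp⟩ := hΛ.finite_projective
  obtain ⟨r, -, hr, -⟩ :=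
    (isReducedNorm_reducedNorm (R := R) hΛ.span_eq_top).evalAt_one_add_X ⟨a, ha⟩
  exact ⟨r, hr⟩

theorem exists_reducedTrace_eq_algebraMap_notMem (hΛ : Maximal (IsOrderIn R k A) Λ) (𝔭 : Ideal R)
    [h𝔭 : 𝔭.IsPrime] (h0 : 𝔭 ≠ ⊥) (hfin : Finite (R ⧸ 𝔭)) :
    ∃ a ∈ Λ, ∃ r ∉ 𝔭, reducedTrace k A a = algebraMap R k r := by
  let O := Localization.AtPrime 𝔭
  have hu (s : 𝔭.primeCompl) : IsUnit (algebraMap R k s) :=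
    IsUnit.mk0 _ fun h => s.2 <| by
      rw [FaithfulSMul.algebraMap_eq_zero_iff] at h
      rw [h]
      exact 𝔭.zero_mem
  let : Algebra O k := (IsLocalization.lift (M := 𝔭.primeCompl) hu).toAlgebra
  have : IsScalarTower R O k := .of_algebraMap_eq fun r => (IsLocalization.lift_eq hu r).symm
  let : Algebra O A := Algebra.compHom A (algebraMap O k)
  have : IsScalarTower O k A := .of_algebraMap_eq fun r => rfl
  have : IsScalarTower R O A := .of_algebraMap_eq fun r => by
    rw [IsScalarTower.algebraMap_apply O k A, ← IsScalarTower.algebraMap_apply R O k,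
      IsScalarTower.algebraMap_apply R k A]
  have : IsFractionRing O k :=
    IsFractionRing.isFractionRing_of_isDomain_of_isLocalization 𝔭.primeCompl O k
  have : IsDiscreteValuationRing O :=
    IsLocalization.AtPrime.isDiscreteValuationRing_of_dedekind_domain R h0 O
  have hmax : 𝔭.IsMaximal := h𝔭.isMaximal h0
  have hRA : Module.IsTorsionFree R A := .trans_faithfulSMul R k A
  have hO : Finite (O ⧸ IsLocalRing.maximalIdeal O) :=
    Finite.of_equiv _ (IsLocalization.AtPrime.equivQuotMaximalIdeal 𝔭 O).toEquiv
  obtain ⟨a, ⟨s, hs, ha⟩, htr⟩ := exists_reducedTrace_ne_algebraMap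
    (hΛ.prop.atPrime (𝔭 := 𝔭) (O := O)) hO fun I _ ⟨c, hc, hcI⟩ y hy =>
      mem_atPrime_of_forall_mul_mem hΛ I hc hcI hy
  obtain ⟨r, hr⟩ := hΛ.prop.exists_algebraMap_eq_reducedTrace ha
  let t : 𝔭.primeCompl := ⟨s, hs⟩
  -- The witness is `s • a`, of trace `r`. If `r` were in `𝔭`, the trace `r / s` of `a` would lie in
  -- the maximal ideal of `O`.
  refine ⟨_, ha, r, fun hr𝔭 => htr (IsLocalization.mk' O r t) ?_ ?_, hr.symm⟩
  · rwa [IsLocalization.AtPrime.mk'_mem_maximal_iff O 𝔭]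
  · refine mul_left_cancel₀ (hu t).ne_zero ?_
    rw [IsScalarTower.algebraMap_apply R O k t, ← map_mul, IsLocalization.mk'_spec',
      ← IsScalarTower.algebraMap_apply, ← IsScalarTower.algebraMap_apply, hr,
      ← algebraMap_smul k s a, map_smul, smul_eq_mul]

/-- Maximal orders with finite residue fields are smooth. -/
theorem isSmoothOrder_of_maximal (hfin : ∀ P : Ideal R, P.IsPrime → P ≠ ⊥ → Finite (R ⧸ P))
    (hΛ : Maximal (IsOrderIn R k A) Λ) : IsSmoothOrder R k A Λ := by
  -- The ideal of those elements of `R` that are reduced traces from `Λ`; it lies in no maximal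
  -- ideal.
  let T : Ideal R := ((Subalgebra.toSubmodule Λ).map ((reducedTrace k A).restrictScalars R)).comap
    (Algebra.linearMap R k)
  have hT {r : R} : r ∈ T ↔ ∃ a ∈ Λ, reducedTrace k A a = algebraMap R k r := Iff.rfl
  have htop : T = ⊤ := by
    by_contra hne
    obtain ⟨𝔪, h𝔪, hle⟩ := Ideal.exists_le_maximal T hne
    -- The zero ideal is maximal only when `R` is a field; then the trace `n` of `1`, non-zero in
    -- characteristic zero, suffices.
    by_cases h0 : 𝔪 = ⊥
    · obtain ⟨n, hn, ⟨φ⟩⟩ := exists_splitting_algebraicClosure k A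
      have h1 : reducedTrace k A 1 = n := by
        refine (algebraMap k (AlgebraicClosure k)).injective ?_
        rw [isReducedTrace_reducedTrace k A _ n φ, ← Algebra.TensorProduct.one_def, map_one,
          Matrix.trace_one, Fintype.card_fin, map_natCast]
      have h2 := hle (hT.2 ⟨1, Λ.one_mem, by rw [h1, map_natCast]⟩ : (n : R) ∈ T)
      rw [h0, Ideal.mem_bot] at h2
      have := congrArg (algebraMap R k) h2
      rw [map_natCast, map_zero, Nat.cast_eq_zero] at this
      exact hn this
    · obtain ⟨a, ha, r, hr, har⟩ :=
        exists_reducedTrace_eq_algebraMap_notMem hΛ 𝔪 h0 (hfin 𝔪 h𝔪.isPrime h0)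
      exact hr (hle (hT.2 ⟨a, ha, har⟩))
  ext x
  constructor
  · rintro ⟨a, ha, rfl⟩
    exact hΛ.prop.exists_algebraMap_eq_reducedTrace ha
  · rintro ⟨r, rfl⟩
    exact hT.1 (htop ▸ Submodule.mem_top : r ∈ T)

end

theorem mainTheorem9 {R : Type u} {k : Type v} {A : Type w}
    [CommRing R] [IsDedekindDomain R] [Field k] [CharZero k] [Algebra R k] [IsFractionRing R k]
    [Ring A] [Algebra k A] [FiniteDimensional k A] [Algebra.IsCentral k A] [IsSimpleRing A]
    [Algebra R A] [IsScalarTower R k A]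
    (hfin : ∀ P : Ideal R, P.IsPrime → P ≠ ⊥ → Finite (R ⧸ P))
    (Λ : Subalgebra R A) (hΛ : Maximal (IsOrderIn R k A) Λ) :
    -- the reduced trace and the reduced norm are well defined
    (∃! t : A →ₗ[k] k, IsReducedTrace k A t) ∧
    (∃! ν : SymmetricAlgebra R (Module.Dual R Λ), IsReducedNorm R k A Λ ν) ∧
    -- the order is smooth
    IsSmoothOrder R k A Λ ∧
    -- the special linear group is a smooth group scheme
    IsSmoothGroupSchemeSL.{u, v, w, x} R k A Λ := by
  have hspan := hΛ.prop.span_eq_top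
  obtain ⟨hf, hp⟩ := hΛ.prop.finite_projective
  have hs := isSmoothOrder_of_maximal hfin hΛ
  obtain ⟨a, ha, ha1⟩ : (1 : k) ∈ reducedTrace k A '' (Λ : Set A) := by
    rw [show _ = _ from hs]
    exact ⟨1, map_one _⟩
  exact ⟨existsUnique_isReducedTrace k A, existsUnique_isReducedNorm hspan, hs,
    isSmoothGroupSchemeSL_of_reducedTrace_eq_one hspan (a := ⟨a, ha⟩) ha1⟩
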